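/- Let $k$ be an algebraically closed field, $R=k[x,y,z]$ with its standard grading, and $X=V(f)\subset\mathbb P^2_k$ a reduced curve of degree $d+1\ge 2$; that is, $f\in R$ is a nonzero homogeneous polynomial of degree $d+1$ with $(f)$ a radical ideal. Assume that $\operatorname{char} k$ does not divide $d+1$. Let $\mathrm{Syz}(J_f)=\{(a,b,c)\in R^3 : a f_x+b f_y+c f_z=0\}$, graded by the degree of the coordinates, and let $e$ be its initial degree, i.e. the least degree of a nonzero homogeneous element. For a nonzero homogeneous $\epsilon\in\mathrm{Syz}(J_f)$ of degree $e$ (such an $\epsilon$ is a minimal generator), a Bourbaki ideal of $f$ with respect to $\epsilon$ is a homogeneous ideal $I_\epsilon\subseteq R$ that has codimension two or equals $R$ (the latter being the case of free divisors), together with an exact sequence of graded $R$-modules $$0\to R(-e)\xrightarrow{\ 1\mapsto\epsilon\ }\mathrm{Syz}(J_f)\to I_\epsilon(e-d)\to 0 .$$ The Bourbaki degree $\mathrm{Bour}(X)$ is the degree (multiplicity) of $R/I_\epsilon$, which is $0$ if $I_\epsilon=R$. Then: 1. $\mathrm{Bour}(X)$ is well defined: such $\epsilon$ exist, for each of them there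 is a Bourbaki ideal $I_\epsilon$, and the degree of $R/I_\epsilon$ depends neither on $\epsilon$ nor on $I_\epsilon$. 2. $\mathrm{Bour}(X)=d^2$ if and only if $X$ is smooth. 3. If $X$ is smooth, then $f_x,f_y,f_z$ is an $R$-regular sequence, $\mathrm{Syz}(J_f)$ is generated by the Koszul relations of $f_x,f_y,f_z$, and $e=d$. -/

import Mathlib

open MvPolynomial Filter

noncomputable section

namespace PlaneCurve

attribute [local instance] MvPolynomial.gradedAlgebra

variable {k : Type*} [Field k]

/-- The module `Syz(J_f)` of syzygies `(g₀, g₁, g₂)`, `∑ gᵢ ∂f/∂xᵢ = 0`, of the partial derivatives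
of `f ∈ R = k[x₀, x₁, x₂]`, as a submodule of `R³`. The degree of a syzygy is the common degree of
its coordinates (standard degree). -/
def syz (f : MvPolynomial (Fin 3) k) :
    Submodule (MvPolynomial (Fin 3) k) (Fin 3 → MvPolynomial (Fin 3) k) :=
  LinearMap.ker (Fintype.linearCombination (MvPolynomial (Fin 3) k) (fun i => pderiv i f))

/-- A vector of polynomials is homogeneous of degree `n`. -/
def IsHomogeneousVec (s : Fin 3 → MvPolynomial (Fin 3) k) (n : ℕ) : Prop :=
  ∀ i, (s i).IsHomogeneous n

/-- The initial degree of the graded module `Syz(J_f)`: the least degree of a nonzero homogeneous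
syzygy. -/
def indeg (f : MvPolynomial (Fin 3) k) : ℕ :=
  sInf {n : ℕ | ∃ s ∈ syz f, s ≠ 0 ∧ IsHomogeneousVec s n}

/-- `ε` is a nonzero homogeneous syzygy of initial degree. By minimality of its degree such an `ε`
does not lie in `(x₀, x₁, x₂) Syz(J_f)`: it is a minimal generator of `Syz(J_f)`, and every minimal
homogeneous generator of initial degree is of this form. -/
def IsInitialSyzygy (f : MvPolynomial (Fin 3) k) (ε : syz f) : Prop :=
  ε ≠ 0 ∧ IsHomogeneousVec (ε : Fin 3 → MvPolynomial (Fin 3) k) (indeg f)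

/-- `I` is a Bourbaki ideal of `f` with respect to the syzygy `ε` of initial degree `e`: a
homogeneous ideal, either of codimension two or (free divisors) equal to `R`, which sits in
an exact sequence of graded modules `0 → R(-e) → Syz(J_f) → I(e - d) → 0`, where `deg f = d + 1`,
whose first map is `1 ↦ ε`.  In other words, the second map identifies `Syz(J_f) / R ε` with
`I(e - d)`; it sends a syzygy of degree `n` to an element of degree `m = n + e - d` of `I`
(to `0` if `n + e < d`). -/
def IsBourbakiIdeal (f : MvPolynomial (Fin 3) k) (ε : syz f)
    (I : Ideal (MvPolynomial (Fin 3) k)) : Prop :=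
  I.IsHomogeneous (homogeneousSubmodule (Fin 3) k) ∧
  (I = ⊤ ∨ I.height = 2) ∧
  ∃ π : syz f →ₗ[MvPolynomial (Fin 3) k] MvPolynomial (Fin 3) k,
    LinearMap.ker π = Submodule.span (MvPolynomial (Fin 3) k) {ε} ∧
    LinearMap.range π = I ∧
    ∀ (n : ℕ) (s : syz f), IsHomogeneousVec (s : Fin 3 → MvPolynomial (Fin 3) k) n →
      π s = 0 ∨ ∃ m : ℕ, m + f.totalDegree = n + indeg f + 1 ∧ (π s).IsHomogeneous m

/-- The Hilbert function `n ↦ dim_k (R / I)_n`, where `(R / I)_n` is the image of `R_n`. -/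
def hilbertFunction (I : Ideal (MvPolynomial (Fin 3) k)) (n : ℕ) : ℕ :=
  Module.finrank k
    ((homogeneousSubmodule (Fin 3) k n).map (Ideal.Quotient.mkₐ k I).toLinearMap)

open Classical in
/-- The Hilbert polynomial of `R / I`: the polynomial that agrees with the Hilbert function in all
large degrees. It exists for every homogeneous ideal, and is unique. -/
def hilbertPolynomial (I : Ideal (MvPolynomial (Fin 3) k)) : Polynomial ℚ :=
  if h : ∃ P : Polynomial ℚ, ∀ᶠ n : ℕ in atTop, (hilbertFunction I n : ℚ) = P.eval (n : ℚ)
  then h.choose else 0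

open Classical in
/-- The degree (multiplicity) of `R / I` for a homogeneous ideal `I`: if the Hilbert polynomial is
nonzero, of degree `r = dim (R / I) - 1`, it is `r!` times its leading coefficient; if it is zero,
so that `R / I` has finite length, it is that length. -/
def quotientDegree (I : Ideal (MvPolynomial (Fin 3) k)) : ℚ :=
  if hilbertPolynomial I = 0 then ∑ᶠ n : ℕ, (hilbertFunction I n : ℚ)
  else ((hilbertPolynomial I).natDegree.factorial : ℚ) * (hilbertPolynomial I).leadingCoeff

open Classical in
/-- The Bourbaki degree `Bour(f)`: the degree of `R / I`, for a Bourbaki ideal `I` of `f` with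
respect to a syzygy of initial degree. -/
def bourbakiDegree (f : MvPolynomial (Fin 3) k) : ℚ :=
  if h : ∃ I : Ideal (MvPolynomial (Fin 3) k),
      ∃ ε : syz f, IsInitialSyzygy f ε ∧ IsBourbakiIdeal f ε I
  then quotientDegree h.choose else 0

/-- The projective plane curve `V(f)` (over an algebraically closed field) is smooth: at no point
of the curve do all partial derivatives vanish. -/
def IsSmooth (f : MvPolynomial (Fin 3) k) : Prop :=
  ∀ p : Fin 3 → k, p ≠ 0 → eval p f = 0 → ∃ i, eval p (pderiv i f) ≠ 0

/-- The Koszul syzygy `(∂f/∂xⱼ) eᵢ - (∂f/∂xᵢ) eⱼ`. -/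
def koszul (f : MvPolynomial (Fin 3) k) (i j : Fin 3) : Fin 3 → MvPolynomial (Fin 3) k :=
  Pi.single i (pderiv j f) - Pi.single j (pderiv i f)

end PlaneCurve

end

/-!
Let `g = ∇f`, `J = (g₀, g₁, g₂)`, and let `ε` be a syzygy of the initial degree `e`; here
`e ≤ d` because of the Koszul syzygies.

*Bourbaki ideals exist.* The coordinates of `g` have no common factor, by Euler's identity and since
`f` is squarefree (`isPrimitiveVec_grad`); nor do those of `ε`, by minimality of `e`
(`IsInitialSyzygy.isPrimitiveVec`). For a syzygy `s`, both `ε` and `s` are orthogonal to `g`, so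
`ε × s = π(s) g` for a polynomial `π(s)`. The kernel of `π` is `R ε`; its image `I` contains the
coordinates of `ε`, hence lies in no prime ideal of height one. Moreover `I` is saturated, because
`Syz(J)` has depth at least two (`isSaturated_range`). A saturated ideal different from `R` has a
zero in the projective plane, so the height of `I` is two (`eq_top_or_height_eq_two`).

*The degree is well defined.* The exact sequence of any Bourbaki ideal expresses its Hilbert
function through those of `R` and `Syz(J)` (`hilbertFunction_eq`). Together with
`0 → Syz(J) → R³ → J(d) → 0` it gives `H_{R/I}(m) + H_{R/J}(m + 2d - e) = d² - e (d - e)` for large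
`m` (`hilbertFunction_add_jacobian`). Some linear form is a nonzerodivisor modulo the saturated
ideal `I`, so `H_{R/I}` is nondecreasing; being bounded, it is eventually constant. Thus
`Bour = d² - e (d - e) - τ`, where `τ` is the eventual value of `H_{R/J}`
(`exists_bourbakiDegree_eq`).

*Smoothness.* By the Nullstellensatz, the curve is smooth if and only if `J` contains a power of
the irrelevant ideal, that is, `τ = 0`. So `Bour = d²` implies smoothness. Conversely, for a smooth
curve `g₀, g₁` are coprime by Krull's height theorem, the ideal `(g₀, g₁)` is saturated, and hence
`g₂` is a nonzerodivisor modulo it (`IsSaturated.mem_of_mul_mem`). So `g` is a regular sequence, its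
syzygies are the Koszul ones, `e = d`, and `Bour = d²`.
-/

noncomputable section

namespace PlaneCurve

/-! ### Homogeneous components -/

section Homogeneous

variable {σ k : Type*} [Field k]

attribute [local instance] MvPolynomial.gradedAlgebra

lemma coe_decompose_eq_homogeneousComponent (a : MvPolynomial σ k) (n : ℕ) :
    (DirectSum.decompose (homogeneousSubmodule σ k) a n : MvPolynomial σ k) =
      homogeneousComponent n a :=
  decomposition.decompose'_apply a n

lemma homogeneousComponent_mul_add {g : MvPolynomial σ k} {d : ℕ} (hg : g.IsHomogeneous d)
    (a : MvPolynomial σ k) (n : ℕ) :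
    homogeneousComponent (n + d) (a * g) = homogeneousComponent n a * g := by
  simp only [← coe_decompose_eq_homogeneousComponent]
  exact DirectSum.coe_decompose_mul_add_of_right_mem (homogeneousSubmodule σ k) hg

lemma homogeneousComponent_mul_of_lt {g : MvPolynomial σ k} {d : ℕ} (hg : g.IsHomogeneous d)
    (a : MvPolynomial σ k) {n : ℕ} (hn : n < d) : homogeneousComponent n (a * g) = 0 := by
  rw [← coe_decompose_eq_homogeneousComponent]
  exact DirectSum.coe_decompose_mul_of_right_mem_of_not_le (homogeneousSubmodule σ k) hg
    (not_le.2 hn)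

lemma eq_zero_of_homogeneousComponent {a : MvPolynomial σ k}
    (h : ∀ n, homogeneousComponent n a = 0) : a = 0 := by
  rw [← sum_homogeneousComponent a]
  exact Finset.sum_eq_zero fun n _ => h n

lemma exists_homogeneousComponent_ne_zero {a : MvPolynomial σ k} (ha : a ≠ 0) :
    ∃ n ≤ a.totalDegree, homogeneousComponent n a ≠ 0 := by
  by_contra! h
  refine ha (eq_zero_of_homogeneousComponent fun n => ?_)
  rcases le_or_gt n a.totalDegree with hn | hn
  · exact h n hn
  · exact homogeneousComponent_eq_zero _ _ hn

lemma isHomogeneous_of_mul_right {a g : MvPolynomial σ k} {d N : ℕ} (hg : g.IsHomogeneous d)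
    (hg0 : g ≠ 0) (ha0 : a ≠ 0) (h : (a * g).IsHomogeneous N) :
    ∃ m, m + d = N ∧ a.IsHomogeneous m := by
  have key : ∀ n, n + d ≠ N → homogeneousComponent n a = 0 := fun n hn => by
    have := homogeneousComponent_mul_add hg a n
    rw [homogeneousComponent_of_mem h, if_neg hn] at this
    exact (mul_eq_zero.1 this.symm).resolve_right hg0
  obtain ⟨m, -, hm⟩ := exists_homogeneousComponent_ne_zero ha0
  have hmN : m + d = N := by_contra fun hn => hm (key m hn)
  refine ⟨m, hmN, ?_⟩
  have : homogeneousComponent m a = a := by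
    refine sub_eq_zero.1 (eq_zero_of_homogeneousComponent fun n => ?_)
    rw [map_sub, homogeneousComponent_of_mem (homogeneousComponent_isHomogeneous m a)]
    split_ifs with hnm
    · rw [hnm, sub_self]
    · rw [zero_sub, neg_eq_zero]
      exact key n (by omega)
  rw [← this]
  exact homogeneousComponent_isHomogeneous m a

/-- A prime factor of a nonzero homogeneous polynomial vanishes at the origin: the
homogeneous core of the prime ideal `(q)` is a nonzero prime ideal, hence equal to `(q)`, so
that `(q)` is homogeneous. -/
lemma coeff_zero_of_prime_dvd {q F : MvPolynomial σ k} (hq : Prime q) (hF : F ≠ 0) {d : ℕ}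
    (hFd : F.IsHomogeneous d) (hdvd : q ∣ F) : coeff 0 q = 0 := by
  have hP : (Ideal.span {q}).IsPrime := (Ideal.span_singleton_prime hq.ne_zero).2 hq
  set P := Ideal.span {q} with hPdef
  have hcore := hP.homogeneousCore (𝒜 := homogeneousSubmodule σ k)
  set Q := (P.homogeneousCore (homogeneousSubmodule σ k)).toIdeal with hQ
  have hQP : Q ≤ P := Ideal.toIdeal_homogeneousCore_le _ P
  have hFQ : F ∈ Q := Ideal.mem_homogeneousCore_of_homogeneous_of_mem ⟨d, hFd⟩
    (Ideal.mem_span_singleton.2 hdvd)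
  obtain ⟨q', hq'Q, hq'⟩ := hcore.exists_mem_prime_of_ne_bot (fun h => hF (by simpa [h] using hFQ))
  have hqq' : q ∣ q' := Ideal.mem_span_singleton.1 (hQP hq'Q)
  have hq'q : q' ∣ q := (hq.associated_of_dvd hq' hqq').symm.dvd
  have hqQ : q ∈ Q := Q.mem_of_dvd hq'q hq'Q
  have h0 : homogeneousComponent 0 q ∈ Q := homogeneousComponent_mem_of_mem
    (P.homogeneousCore (homogeneousSubmodule σ k)).isHomogeneous hqQ 0
  rw [homogeneousComponent_zero] at h0
  by_contra hne
  exact hP.ne_top (Ideal.eq_top_of_isUnit_mem _ (hQP h0)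
    ((isUnit_iff_ne_zero.2 hne).map MvPolynomial.C))

end Homogeneous

/-! ### Primitive vectors over a factorial ring -/

section Primitive

variable {ι A : Type*} [CommRing A]

/-- A nonzero vector whose coordinates have no common prime factor. -/
def IsPrimitiveVec (v : ι → A) : Prop := v ≠ 0 ∧ ∀ q, Prime q → ∃ i, ¬ q ∣ v i

variable [IsDomain A] [UniqueFactorizationMonoid A]

/-- A vector proportional to a primitive vector over the fraction field is a multiple of it:
if `vⱼ ≠ 0`, then `vⱼ` divides all `uⱼ vᵢ`, hence their greatest common divisor, which is `uⱼ`. -/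
lemma IsPrimitiveVec.exists_eq_smul [Finite ι] {u v : ι → A} (hv : IsPrimitiveVec v)
    (h : ∀ i j, u i * v j = u j * v i) : ∃ a : A, u = a • v := by
  classical
  have := Fintype.ofFinite ι
  let : NormalizationMonoid A :=
    UniqueFactorizationMonoid.strongNormalizationMonoid.toNormalizationMonoid
  let : NormalizedGCDMonoid A := UniqueFactorizationMonoid.toNormalizedGCDMonoid A
  obtain ⟨j, hj⟩ := Function.ne_iff.1 hv.1
  have hunit : IsUnit (Finset.univ.gcd v) := by
    by_contra hu
    have hne : Finset.univ.gcd v ≠ 0 := fun h0 =>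
      hj (Finset.gcd_eq_zero_iff.1 h0 j (Finset.mem_univ j))
    obtain ⟨q, hq, hqd⟩ := WfDvdMonoid.exists_irreducible_factor hu hne
    obtain ⟨i, hi⟩ := hv.2 q hq.prime
    exact hi (hqd.trans (Finset.gcd_dvd (Finset.mem_univ i)))
  have hdvd : v j ∣ u j := by
    have h1 : v j ∣ Finset.univ.gcd fun i => u j * v i :=
      Finset.dvd_gcd fun i _ => ⟨u i, by rw [← h i j, mul_comm]⟩
    have h2 := h1.trans (Finset.gcd_mul_left' (s := Finset.univ) (f := v) (u j)).dvd
    exact hunit.dvd_mul_right.1 h2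
  obtain ⟨a, ha⟩ := hdvd
  refine ⟨a, funext fun i => mul_right_cancel₀ hj ?_⟩
  rw [h i j, ha, Pi.smul_apply, smul_eq_mul]
  ring

open Matrix

/-- Two vectors orthogonal to a primitive vector `g` have a cross product proportional to `g`. -/
lemma IsPrimitiveVec.exists_cross_eq_smul {g u v : Fin 3 → A} (hg : IsPrimitiveVec g)
    (hu : u ⬝ᵥ g = 0) (hv : v ⬝ᵥ g = 0) : ∃ a : A, u ⨯₃ v = a • g := by
  rw [vec3_dotProduct] at hu hv
  refine hg.exists_eq_smul fun i j => ?_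
  fin_cases i <;> fin_cases j <;> simp [cross_apply] <;> try ring1
  · linear_combination v 2 * hu - u 2 * hv
  · linear_combination u 1 * hv - v 1 * hu
  · linear_combination u 2 * hv - v 2 * hu
  · linear_combination v 0 * hu - u 0 * hv
  · linear_combination v 1 * hu - u 1 * hv
  · linear_combination u 0 * hv - v 0 * hu

lemma IsPrimitiveVec.exists_eq_smul_of_cross_eq_zero {u v : Fin 3 → A} (hu : IsPrimitiveVec u)
    (h : u ⨯₃ v = 0) : ∃ a : A, v = a • u := by
  have h0 := congrFun h 0
  have h1 := congrFun h 1
  have h2 := congrFun h 2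
  simp [cross_apply] at h0 h1 h2
  refine hu.exists_eq_smul fun i j => ?_
  fin_cases i <;> fin_cases j <;> simp
  · linear_combination -h2
  · linear_combination h1
  · linear_combination h2
  · linear_combination -h0
  · linear_combination -h1
  · linear_combination h0

end Primitive

/-! ### The gradient of a reduced curve -/

section Gradient

open Matrix

variable {k : Type*} [Field k]

/-- The vector of partial derivatives of `f`. -/
def grad (f : MvPolynomial (Fin 3) k) : Fin 3 → MvPolynomial (Fin 3) k := fun i => pderiv i f

lemma mem_syz_iff {f : MvPolynomial (Fin 3) k} {s : Fin 3 → MvPolynomial (Fin 3) k} :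
    s ∈ syz f ↔ s ⬝ᵥ grad f = 0 := by
  simp [syz, Fintype.linearCombination_apply, dotProduct, grad]

lemma grad_isHomogeneous {f : MvPolynomial (Fin 3) k} {d : ℕ} (hf : f.IsHomogeneous (d + 1))
    (i : Fin 3) : (grad f i).IsHomogeneous d :=
  hf.pderiv

lemma coeff_pderiv_of_eq_zero {σ : Type*} {q : MvPolynomial σ k} {i : σ} (hq : pderiv i q = 0)
    {s : σ →₀ ℕ} (hs : coeff s q ≠ 0) : (s i : k) = 0 := by
  classical
  by_cases hsi : s i = 0
  · simp [hsi]
  · have hle : Finsupp.single i 1 ≤ s := by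
      rw [Finsupp.single_le_iff]; omega
    have h := congrArg (coeff (s - Finsupp.single i 1)) hq
    rw [coeff_zero] at h
    rw [coeff_pderiv, tsub_add_cancel_of_le hle] at h
    rw [Finsupp.tsub_apply, Finsupp.single_eq_same, ← Nat.cast_add_one,
      Nat.sub_add_cancel (Nat.one_le_iff_ne_zero.2 hsi)] at h
    exact (mul_eq_zero.1 h).resolve_left hs

/-- Over a perfect field, a polynomial with vanishing partial derivatives is constant or a power
with exponent the characteristic; hence it is not prime. -/
lemma exists_pderiv_ne_zero_of_prime {σ : Type*} [PerfectField k] {q : MvPolynomial σ k}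
    (hq : Prime q) : ∃ i, pderiv i q ≠ 0 := by
  classical
  by_contra! h
  obtain ⟨p, hp⟩ := CharP.exists k
  have hdvd : ∀ s ∈ q.support, ∀ i, p ∣ s i := fun s hs i =>
    (CharP.cast_eq_zero_iff k p _).1 (coeff_pderiv_of_eq_zero (h i) (mem_support_iff.1 hs))
  rcases CharP.char_is_prime_or_zero k p with hpp | rfl
  · have : Fact p.Prime := ⟨hpp⟩
    have : ExpChar k p := ExpChar.prime hpp
    have : PerfectRing k p := PerfectField.toPerfectRing p
    have hpow : q = (∑ s ∈ q.support, monomial (s.mapRange (· / p) (Nat.zero_div p))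
        ((frobeniusEquiv k p).symm (coeff s q))) ^ p := by
      rw [sum_pow_char]
      conv_lhs => rw [q.as_sum]
      refine Finset.sum_congr rfl fun s hs => ?_
      rw [monomial_pow]
      congr 1
      · congr 1
        ext i
        simp [Nat.mul_div_cancel' (hdvd s hs i)]
      · rw [← frobenius_def, frobenius_apply_frobeniusEquiv_symm]
    have hirr := hq.irreducible
    rw [hpow] at hirr
    exact not_irreducible_pow hpp.ne_one hirr
  · have hs : ∀ s ∈ q.support, s = 0 := fun s hs => by
      ext i
      simpa using hdvd s hs i
    have : q = C (coeff 0 q) := by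
      ext s
      rw [coeff_C]
      split_ifs with h0
      · rw [h0]
      · by_contra hne
        exact h0 (hs s (mem_support_iff.2 hne)).symm
    have hne : coeff 0 q ≠ 0 := fun h0 => hq.ne_zero (by rw [this, h0, C_0])
    exact hq.not_isUnit (this ▸ (isUnit_iff_ne_zero.2 hne).map C)

lemma pderiv_eq_zero_of_dvd {σ : Type*} {q : MvPolynomial σ k} {i : σ} (h : q ∣ pderiv i q) :
    pderiv i q = 0 := by
  classical
  by_contra hne
  have h1 : (pderiv i q).totalDegree < q.totalDegree := by
    have key : ∀ m ∈ (pderiv i q).support, (m.sum fun _ e => e) < q.totalDegree := by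
      intro m hm
      rw [mem_support_iff, coeff_pderiv] at hm
      have := le_totalDegree (mem_support_iff.2 (left_ne_zero_of_mul hm))
      rw [Finsupp.sum_add_index' (fun _ => rfl) (fun _ _ _ => rfl),
        Finsupp.sum_single_index rfl] at this
      omega
    obtain ⟨m, hm⟩ := support_nonempty.2 hne
    exact (Finset.sup_lt_iff (bot_lt_of_lt (key m hm))).2 key
  exact h1.not_ge (totalDegree_le_of_dvd_of_isDomain h hne)

lemma sum_X_mul_grad {f : MvPolynomial (Fin 3) k} {d : ℕ} (hf : f.IsHomogeneous (d + 1)) :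
    ∑ i, X i * grad f i = C ((d + 1 : ℕ) : k) * f := by
  have := hf.sum_X_mul_pderiv
  rw [nsmul_eq_mul] at this
  rw [map_natCast]
  exact this

lemma grad_ne_zero {f : MvPolynomial (Fin 3) k} {d : ℕ} (hchar : ((d + 1 : ℕ) : k) ≠ 0)
    (hf0 : f ≠ 0) (hf : f.IsHomogeneous (d + 1)) : grad f ≠ 0 := by
  intro h
  have := sum_X_mul_grad hf
  simp only [h, Pi.zero_apply, mul_zero, Finset.sum_const_zero] at this
  exact mul_ne_zero (by rwa [Ne, C_eq_zero]) hf0 this.symm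

/-- The Jacobian ideal of a reduced curve has codimension at least two: its generators have no
common factor. A common prime factor `q` divides `f = q g` by Euler's identity, hence divides all
`(∂q/∂xᵢ) g`; it does not divide `g` because `f` is squarefree, and it does not divide a nonzero
partial derivative of `q` for degree reasons. -/
lemma isPrimitiveVec_grad [PerfectField k] {f : MvPolynomial (Fin 3) k} {d : ℕ}
    (hchar : ((d + 1 : ℕ) : k) ≠ 0) (hf0 : f ≠ 0) (hf : f.IsHomogeneous (d + 1))
    (hred : (Ideal.span {f}).IsRadical) : IsPrimitiveVec (grad f) := by
  refine ⟨grad_ne_zero hchar hf0 hf, fun q hq => ?_⟩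
  by_contra! hall
  have hunit : IsUnit (C ((d + 1 : ℕ) : k) : MvPolynomial (Fin 3) k) :=
    (isUnit_iff_ne_zero.2 hchar).map C
  have hqf : q ∣ f := by
    rw [← hunit.dvd_mul_left, ← sum_X_mul_grad hf]
    exact Finset.dvd_sum fun i _ => (hall i).mul_left _
  obtain ⟨g, hg⟩ := hqf
  have hsq : Squarefree f := (isRadical_iff_span_singleton.2 hred).squarefree hf0
  have hqg : ¬ q ∣ g := by
    rintro ⟨g', rfl⟩
    exact hq.not_isUnit (hsq q ⟨g', by rw [hg, mul_assoc]⟩)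
  obtain ⟨i, hi⟩ := exists_pderiv_ne_zero_of_prime hq
  refine hi (pderiv_eq_zero_of_dvd ?_)
  have h1 : q ∣ pderiv i f := hall i
  rw [hg, Derivation.leibniz, smul_eq_mul, smul_eq_mul] at h1
  exact (hq.dvd_or_dvd ((dvd_add_right (dvd_mul_right q _)).1 h1)).resolve_left hqg

end Gradient

/-! ### Syzygies of initial degree -/

section Syzygies

open Matrix

variable {k : Type*} [Field k] {f : MvPolynomial (Fin 3) k} {d : ℕ}

/-- The homogeneous component of degree `n` of a syzygy. -/
def syzComponent (hf : f.IsHomogeneous (d + 1)) (n : ℕ) (s : syz f) : syz f :=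
  ⟨fun i => homogeneousComponent n ((s : Fin 3 → MvPolynomial (Fin 3) k) i), by
    have h := congrArg (homogeneousComponent (n + d)) (mem_syz_iff.1 s.2)
    rw [mem_syz_iff]
    simpa only [dotProduct, map_sum, map_zero,
      homogeneousComponent_mul_add (grad_isHomogeneous hf _)] using h⟩

lemma syzComponent_apply (hf : f.IsHomogeneous (d + 1)) (n : ℕ) (s : syz f) (i : Fin 3) :
    (syzComponent hf n s : Fin 3 → MvPolynomial (Fin 3) k) i =
      homogeneousComponent n ((s : Fin 3 → MvPolynomial (Fin 3) k) i) := rfl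

lemma isHomogeneousVec_syzComponent (hf : f.IsHomogeneous (d + 1)) (n : ℕ) (s : syz f) :
    IsHomogeneousVec (syzComponent hf n s : Fin 3 → MvPolynomial (Fin 3) k) n :=
  fun _ => homogeneousComponent_isHomogeneous _ _

lemma exists_sum_syzComponent (hf : f.IsHomogeneous (d + 1)) (s : syz f) :
    ∃ N, ∀ M, N ≤ M → ∑ n ∈ Finset.range M, syzComponent hf n s = s := by
  let N := Finset.univ.sup fun i => ((s : Fin 3 → MvPolynomial (Fin 3) k) i).totalDegree
  refine ⟨N + 1, fun M hM => Subtype.ext (funext fun i => ?_)⟩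
  have hi : ((s : Fin 3 → MvPolynomial (Fin 3) k) i).totalDegree ≤ N :=
    Finset.le_sup (f := fun i => ((s : Fin 3 → MvPolynomial (Fin 3) k) i).totalDegree)
      (Finset.mem_univ i)
  rw [AddSubmonoidClass.coe_finsetSum, Finset.sum_apply]
  simp only [syzComponent_apply]
  conv_rhs => rw [← sum_homogeneousComponent ((s : Fin 3 → MvPolynomial (Fin 3) k) i)]
  refine (Finset.sum_subset (Finset.range_mono (by omega)) fun n _ hn => ?_).symm
  exact homogeneousComponent_eq_zero _ _ (by simpa using hn)

lemma koszul_mem_syz (f : MvPolynomial (Fin 3) k) (i j : Fin 3) : koszul f i j ∈ syz f := by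
  rw [mem_syz_iff, koszul, sub_dotProduct, single_dotProduct, single_dotProduct, grad, grad]
  ring

lemma isHomogeneousVec_koszul (hf : f.IsHomogeneous (d + 1)) (i j : Fin 3) :
    IsHomogeneousVec (koszul f i j) d := by
  intro l
  refine IsHomogeneous.sub ?_ ?_
  · rw [Pi.single_apply]
    split_ifs
    · exact grad_isHomogeneous hf j
    · exact isHomogeneous_zero _ _ _
  · rw [Pi.single_apply]
    split_ifs
    · exact grad_isHomogeneous hf i
    · exact isHomogeneous_zero _ _ _

lemma exists_koszul_ne_zero (hg : grad f ≠ 0) : ∃ i j, koszul f i j ≠ 0 := by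
  obtain ⟨j, hj⟩ := Function.ne_iff.1 hg
  obtain ⟨i, hi⟩ := exists_ne j
  refine ⟨i, j, fun h => hj ?_⟩
  simpa [koszul, grad, hi] using congrFun h i

lemma indeg_le {s : Fin 3 → MvPolynomial (Fin 3) k} {n : ℕ} (hs : s ∈ syz f) (hs0 : s ≠ 0)
    (hn : IsHomogeneousVec s n) : indeg f ≤ n :=
  Nat.sInf_le ⟨s, hs, hs0, hn⟩

lemma indeg_le_degree (hf : f.IsHomogeneous (d + 1)) (hg : grad f ≠ 0) : indeg f ≤ d := by
  obtain ⟨i, j, hij⟩ := exists_koszul_ne_zero hg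
  exact indeg_le (koszul_mem_syz f i j) hij (isHomogeneousVec_koszul hf i j)

lemma exists_isInitialSyzygy (hf : f.IsHomogeneous (d + 1)) (hg : grad f ≠ 0) :
    ∃ ε, IsInitialSyzygy f ε := by
  obtain ⟨i, j, hij⟩ := exists_koszul_ne_zero hg
  obtain ⟨s, hs, hs0, hn⟩ := Nat.sInf_mem (s := {n : ℕ | ∃ s ∈ syz f, s ≠ 0 ∧ IsHomogeneousVec s n})
    ⟨d, koszul f i j, koszul_mem_syz f i j, hij, isHomogeneousVec_koszul hf i j⟩
  exact ⟨⟨s, hs⟩, fun h => hs0 (congrArg Subtype.val h), hn⟩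

/-- A syzygy of initial degree is primitive: a common prime factor could be cancelled, and some
homogeneous component of the quotient would be a nonzero syzygy of smaller degree. -/
lemma IsInitialSyzygy.isPrimitiveVec (hf : f.IsHomogeneous (d + 1)) {ε : syz f}
    (hε : IsInitialSyzygy f ε) :
    IsPrimitiveVec (ε : Fin 3 → MvPolynomial (Fin 3) k) := by
  refine ⟨fun h => hε.1 (Subtype.ext h), fun q hq => ?_⟩
  by_contra! hall
  choose t ht using hall
  have htε : (ε : Fin 3 → MvPolynomial (Fin 3) k) = q • t := funext ht
  have hts : t ∈ syz f := by
    have h := mem_syz_iff.1 ε.2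
    rw [htε, smul_dotProduct, smul_eq_mul] at h
    exact mem_syz_iff.2 ((mul_eq_zero.1 h).resolve_left hq.ne_zero)
  have ht0 : t ≠ 0 := by
    rintro rfl
    exact hε.1 (Subtype.ext (by rw [htε, smul_zero]; rfl))
  obtain ⟨i, hi⟩ := Function.ne_iff.1 ht0
  obtain ⟨n, hn, hcomp⟩ := exists_homogeneousComponent_ne_zero hi
  have h1 : indeg f ≤ n := indeg_le (syzComponent hf n ⟨t, hts⟩).2
    (fun h => hcomp (congrFun h i)) (isHomogeneousVec_syzComponent hf n ⟨t, hts⟩)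
  have h2 : q.totalDegree + (t i).totalDegree ≤ indeg f := by
    rw [← totalDegree_mul_of_isDomain hq.ne_zero hi, ← ht i]
    exact (hε.2 i).totalDegree_le
  have h3 : q.totalDegree ≠ 0 := fun h => by
    rw [totalDegree_eq_zero_iff_eq_C] at h
    have hne : coeff 0 q ≠ 0 := fun h0 => hq.ne_zero (by rw [h, h0, C_0])
    exact hq.not_isUnit (h ▸ (isUnit_iff_ne_zero.2 hne).map C)
  omega

end Syzygies

/-! ### The Bourbaki map -/

section BourbakiMap

open Matrix

variable {k : Type*} [Field k] {f : MvPolynomial (Fin 3) k} {d : ℕ}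

/-- For a syzygy `ε` of a gradient `g` without common factor, there is a linear form `π` on the
syzygies with `ε × s = π(s) g`. -/
lemma exists_linearMap_cross_eq_smul (hg : IsPrimitiveVec (grad f)) (ε : syz f) :
    ∃ π : syz f →ₗ[MvPolynomial (Fin 3) k] MvPolynomial (Fin 3) k,
      ∀ s : syz f, (ε : Fin 3 → MvPolynomial (Fin 3) k) ⨯₃ s = π s • grad f := by
  have h := fun s : syz f =>
    hg.exists_cross_eq_smul (mem_syz_iff.1 ε.2) (mem_syz_iff.1 s.2)
  choose φ hφ using h
  have hinj : Function.Injective fun a : MvPolynomial (Fin 3) k => a • grad f :=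
    smul_left_injective _ hg.1
  refine ⟨⟨⟨φ, fun s t => hinj ?_⟩, fun a s => hinj ?_⟩, hφ⟩
  · simp only [add_smul, ← hφ]
    simp
  · simp only [smul_assoc, ← hφ, RingHom.id_apply]
    simp

/-- A linear form on the syzygies is graded of the degree prescribed for Bourbaki ideals. -/
def IsBourbakiGraded (f : MvPolynomial (Fin 3) k)
    (π : syz f →ₗ[MvPolynomial (Fin 3) k] MvPolynomial (Fin 3) k) : Prop :=
  ∀ (n : ℕ) (s : syz f), IsHomogeneousVec (s : Fin 3 → MvPolynomial (Fin 3) k) n →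
    π s = 0 ∨ ∃ m : ℕ, m + f.totalDegree = n + indeg f + 1 ∧ (π s).IsHomogeneous m

lemma isHomogeneous_cross {u v : Fin 3 → MvPolynomial (Fin 3) k} {m n : ℕ}
    (hu : IsHomogeneousVec u m) (hv : IsHomogeneousVec v n) : IsHomogeneousVec (u ⨯₃ v) (n + m) := by
  rw [add_comm]
  intro i
  fin_cases i
  · exact ((hu 1).mul (hv 2)).sub ((hu 2).mul (hv 1))
  · exact ((hu 2).mul (hv 0)).sub ((hu 0).mul (hv 2))
  · exact ((hu 0).mul (hv 1)).sub ((hu 1).mul (hv 0))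

section CrossProduct

variable {ε : syz f} {π : syz f →ₗ[MvPolynomial (Fin 3) k] MvPolynomial (Fin 3) k}

lemma isBourbakiGraded_of_cross (hf0 : f ≠ 0) (hf : f.IsHomogeneous (d + 1)) (hg : grad f ≠ 0)
    (hε : IsInitialSyzygy f ε)
    (hπ : ∀ s : syz f, (ε : Fin 3 → MvPolynomial (Fin 3) k) ⨯₃ s = π s • grad f) :
    IsBourbakiGraded f π := by
  intro n s hs
  rw [or_iff_not_imp_left]
  intro h0
  obtain ⟨i, hi⟩ := Function.ne_iff.1 hg
  have h1 := isHomogeneous_cross hε.2 hs i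
  rw [hπ] at h1
  obtain ⟨m, hm, hm'⟩ := isHomogeneous_of_mul_right (grad_isHomogeneous hf i) hi h0 h1
  refine ⟨m, ?_, hm'⟩
  rw [hf.totalDegree hf0]
  omega

lemma ker_of_cross (hg : grad f ≠ 0) (hε : IsPrimitiveVec (ε : Fin 3 → MvPolynomial (Fin 3) k))
    (hπ : ∀ s : syz f, (ε : Fin 3 → MvPolynomial (Fin 3) k) ⨯₃ s = π s • grad f) :
    LinearMap.ker π = Submodule.span (MvPolynomial (Fin 3) k) {ε} := by
  ext s
  rw [LinearMap.mem_ker, Submodule.mem_span_singleton]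
  constructor
  · intro h
    have h1 := hπ s
    rw [h, zero_smul] at h1
    obtain ⟨a, ha⟩ := hε.exists_eq_smul_of_cross_eq_zero h1
    exact ⟨a, Subtype.ext ha.symm⟩
  · rintro ⟨a, rfl⟩
    have h1 := hπ (a • ε)
    rw [Submodule.coe_smul, map_smul, cross_self, smul_zero] at h1
    exact (smul_eq_zero.1 h1.symm).resolve_right hg

/-- The coordinates of `ε` lie in the image of the Bourbaki map: they are, up to sign, the images
of the Koszul syzygies `eᵢ × g`, because `ε × (eᵢ × g) = (ε · g) eᵢ - (ε · eᵢ) g`. -/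
lemma coord_mem_range_of_cross (hg : grad f ≠ 0)
    (hπ : ∀ s : syz f, (ε : Fin 3 → MvPolynomial (Fin 3) k) ⨯₃ s = π s • grad f) (i : Fin 3) :
    (ε : Fin 3 → MvPolynomial (Fin 3) k) i ∈ LinearMap.range π := by
  let t : Fin 3 → MvPolynomial (Fin 3) k := grad f ⨯₃ Pi.single i 1
  have ht : t ∈ syz f := by
    rw [mem_syz_iff, dotProduct_comm, dot_self_cross]
  refine ⟨⟨t, ht⟩, ?_⟩
  have h1 := hπ ⟨t, ht⟩
  have h2 : (ε : Fin 3 → MvPolynomial (Fin 3) k) ⨯₃ t =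
      (ε : Fin 3 → MvPolynomial (Fin 3) k) i • grad f := by
    rw [cross_cross_eq_smul_sub_smul', dotProduct_comm (grad f), mem_syz_iff.1 ε.2]
    simp
  rw [h2] at h1
  exact (smul_left_injective _ hg h1).symm

end CrossProduct

/-- A graded Bourbaki map commutes with taking homogeneous components, up to the shift by `e - d`;
the image of a component of any other degree has no component of degree `m`. -/
lemma IsBourbakiGraded.homogeneousComponent_apply (hf0 : f ≠ 0) (hf : f.IsHomogeneous (d + 1))
    {π : syz f →ₗ[MvPolynomial (Fin 3) k] MvPolynomial (Fin 3) k} (hπ : IsBourbakiGraded f π)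
    {m n : ℕ} (hmn : m + d = n + indeg f) (s : syz f) :
    homogeneousComponent m (π s) = π (syzComponent hf n s) := by
  have key : ∀ l, homogeneousComponent m (π (syzComponent hf l s)) =
      if l = n then π (syzComponent hf l s) else 0 := by
    intro l
    rcases hπ l _ (isHomogeneousVec_syzComponent hf l s) with h | ⟨m', hm', h⟩
    · simp [h]
    · rw [homogeneousComponent_of_mem h]
      rw [hf.totalDegree hf0] at hm'
      exact if_congr (by omega) rfl rfl
  obtain ⟨N, hN⟩ := exists_sum_syzComponent hf s
  conv_lhs => rw [← hN (max N (n + 1)) (le_max_left _ _)]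
  rw [map_sum, map_sum]
  simp only [key]
  rw [Finset.sum_ite_eq', if_pos (Finset.mem_range.2 (by omega))]

end BourbakiMap

/-! ### Saturated ideals -/

section Saturated

variable {k : Type*} [Field k]

/-- An ideal `I` of the polynomial ring is saturated if it contains every `h` with
`xᵢ h ∈ I` for all `i`. -/
def IsSaturated (I : Ideal (MvPolynomial (Fin 3) k)) : Prop :=
  ∀ h, (∀ i, X i * h ∈ I) → h ∈ I

lemma IsSaturated.mem_of_pow_le {I : Ideal (MvPolynomial (Fin 3) k)} (hI : IsSaturated I) (N : ℕ) :
    ∀ h, (∀ p ∈ idealOfVars (Fin 3) k ^ N, p * h ∈ I) → h ∈ I := by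
  induction N with
  | zero => exact fun h hh => by simpa using hh 1 (by simp)
  | succ N ih =>
    refine fun h hh => hI h fun i => ih _ fun p hp => ?_
    rw [← mul_assoc]
    refine hh _ ?_
    rw [pow_succ]
    exact Ideal.mul_mem_mul hp (Ideal.subset_span ⟨i, rfl⟩)

lemma IsSaturated.eq_top_of_pow_le {I : Ideal (MvPolynomial (Fin 3) k)} (hI : IsSaturated I)
    {N : ℕ} (h : idealOfVars (Fin 3) k ^ N ≤ I) : I = ⊤ :=
  (Ideal.eq_top_iff_one I).2 (hI.mem_of_pow_le N 1 fun p hp => by simpa using h hp)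

/-- If `I` is saturated and `I + (g)` contains a power of the irrelevant ideal, then `g` is a
nonzerodivisor modulo `I`. -/
lemma IsSaturated.mem_of_mul_mem {I : Ideal (MvPolynomial (Fin 3) k)} (hI : IsSaturated I)
    {N : ℕ} {g : MvPolynomial (Fin 3) k} (h : idealOfVars (Fin 3) k ^ N ≤ I ⊔ Ideal.span {g})
    {a : MvPolynomial (Fin 3) k} (ha : g * a ∈ I) : a ∈ I := by
  refine hI.mem_of_pow_le N a fun p hp => ?_
  obtain ⟨b, hb, c, hc, rfl⟩ := Submodule.mem_sup.1 (h hp)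
  obtain ⟨c, rfl⟩ := Ideal.mem_span_singleton.1 hc
  rw [add_mul, mul_right_comm]
  exact I.add_mem (I.mul_mem_right _ hb) (I.mul_mem_right _ ha)

lemma isPrimitiveVec_X : IsPrimitiveVec (X : Fin 3 → MvPolynomial (Fin 3) k) := by
  refine ⟨Function.ne_iff.2 ⟨0, X_ne_zero 0⟩, fun q hq => ?_⟩
  by_contra! h
  have h01 : (X 0 : MvPolynomial (Fin 3) k) ∣ X 1 :=
    (hq.associated_of_dvd (X_prime (i := 0)) (h 0)).symm.dvd.trans (h 1)
  exact absurd (X_dvd_X.1 h01) (by simp)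

lemma mem_span_X_of_X_mul_mem {p : MvPolynomial (Fin 3) k}
    (h : X 0 * p ∈ Ideal.span ({X 1, X 2} : Set (MvPolynomial (Fin 3) k))) :
    p ∈ Ideal.span ({X 1, X 2} : Set (MvPolynomial (Fin 3) k)) := by
  rw [← Set.image_pair, mem_ideal_span_X_image] at h ⊢
  intro m hm
  have : m + Finsupp.single 0 1 ∈ (X 0 * p).support := by
    rw [mem_support_iff, mul_comm, coeff_mul_X]
    exact mem_support_iff.1 hm
  obtain ⟨i, hi, hmi⟩ := h _ this
  refine ⟨i, hi, ?_⟩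
  rcases hi with rfl | rfl <;> simpa using hmi

/-- Exactness of the Koszul complex of the variables in degree one. -/
lemma exists_koszul_of_sum_eq_zero {a b c : MvPolynomial (Fin 3) k}
    (h : X 0 * a + X 1 * b + X 2 * c = 0) :
    ∃ u v w, a = X 1 * w - X 2 * v ∧ b = X 2 * u - X 0 * w ∧ c = X 0 * v - X 1 * u := by
  have ha : a ∈ Ideal.span ({X 1, X 2} : Set (MvPolynomial (Fin 3) k)) := by
    refine mem_span_X_of_X_mul_mem (Ideal.mem_span_pair.2 ⟨-b, -c, ?_⟩)
    linear_combination -h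
  obtain ⟨w, v, hwv⟩ := Ideal.mem_span_pair.1 ha
  have h1 : X 1 * (b + X 0 * w) + X 2 * (c + X 0 * v) = 0 := by
    rw [← hwv] at h
    linear_combination h
  have h2 : (X 2 : MvPolynomial (Fin 3) k) ∣ X 1 * (b + X 0 * w) :=
    ⟨-(c + X 0 * v), by linear_combination h1⟩
  obtain ⟨u, hu⟩ := ((X_prime (i := 2)).dvd_or_dvd h2).resolve_left
    fun h => absurd (X_dvd_X.1 h) (by simp)
  refine ⟨u, -v, w, by rw [← hwv]; ring, by rw [← hu]; ring, ?_⟩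
  have h3 : X 2 * (c + X 0 * v + X 1 * u) = 0 := by
    rw [hu] at h1
    linear_combination h1
  linear_combination (mul_eq_zero.1 h3).resolve_left (X_ne_zero 2)

/-- Depth counting made explicit. If `0 → R e → M → I → 0` is exact, `R e` is free, and `M` has
the property that a family `(sᵢ)` with `xⱼ sᵢ = xᵢ sⱼ` is of the form `(xᵢ t)`, then the ideal `I`
is saturated: lifts `sᵢ` of `xᵢ h` satisfy these equations up to multiples of `e`, and by exactness
of the Koszul complex of the variables the lifts can be corrected by multiples of `e`. -/
lemma isSaturated_range {M : Type*} [AddCommGroup M] [Module (MvPolynomial (Fin 3) k) M]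
    (π : M →ₗ[MvPolynomial (Fin 3) k] MvPolynomial (Fin 3) k) (e : M)
    (hker : LinearMap.ker π = Submodule.span (MvPolynomial (Fin 3) k) {e})
    (he : ∀ a : MvPolynomial (Fin 3) k, a • e = 0 → a = 0)
    (hM : ∀ s : Fin 3 → M,
      (∀ i j, (X j : MvPolynomial (Fin 3) k) • s i = (X i : MvPolynomial (Fin 3) k) • s j) →
      ∃ t, ∀ i, s i = (X i : MvPolynomial (Fin 3) k) • t) :
    IsSaturated (LinearMap.range π) := by
  intro h hh
  choose s hs using hh
  have hmem : ∀ i j, ∃ a : MvPolynomial (Fin 3) k,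
      a • e = (X i : MvPolynomial (Fin 3) k) • s j - (X j : MvPolynomial (Fin 3) k) • s i := by
    intro i j
    rw [← Submodule.mem_span_singleton, ← hker, LinearMap.mem_ker, map_sub, map_smul, map_smul,
      hs, hs, smul_eq_mul, smul_eq_mul]
    ring
  obtain ⟨a, ha⟩ := hmem 1 2
  obtain ⟨b, hb⟩ := hmem 2 0
  obtain ⟨c, hc⟩ := hmem 0 1
  have habc : X 0 * a + X 1 * b + X 2 * c = 0 := by
    refine he _ ?_
    rw [add_smul, add_smul, mul_smul, mul_smul, mul_smul, ha, hb, hc]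
    module
  obtain ⟨u, v, w, h0, h1, h2⟩ := exists_koszul_of_sum_eq_zero habc
  subst h0 h1 h2
  obtain ⟨t, ht⟩ := hM ![s 0 - u • e, s 1 - v • e, s 2 - w • e] (by
    have e12 : (X 1 : MvPolynomial (Fin 3) k) • (s 2 - w • e) =
        (X 2 : MvPolynomial (Fin 3) k) • (s 1 - v • e) := by
      rw [← sub_eq_zero]
      have : (X 1 : MvPolynomial (Fin 3) k) • (s 2 - w • e) - (X 2 : MvPolynomial (Fin 3) k) •
          (s 1 - v • e) = ((X 1 : MvPolynomial (Fin 3) k) • s 2 -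
          (X 2 : MvPolynomial (Fin 3) k) • s 1) - (X 1 * w - X 2 * v) • e := by module
      rw [this, ha, sub_self]
    have e20 : (X 2 : MvPolynomial (Fin 3) k) • (s 0 - u • e) =
        (X 0 : MvPolynomial (Fin 3) k) • (s 2 - w • e) := by
      rw [← sub_eq_zero]
      have : (X 2 : MvPolynomial (Fin 3) k) • (s 0 - u • e) - (X 0 : MvPolynomial (Fin 3) k) •
          (s 2 - w • e) = ((X 2 : MvPolynomial (Fin 3) k) • s 0 -
          (X 0 : MvPolynomial (Fin 3) k) • s 2) - (X 2 * u - X 0 * w) • e := by module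
      rw [this, hb, sub_self]
    have e01 : (X 0 : MvPolynomial (Fin 3) k) • (s 1 - v • e) =
        (X 1 : MvPolynomial (Fin 3) k) • (s 0 - u • e) := by
      rw [← sub_eq_zero]
      have : (X 0 : MvPolynomial (Fin 3) k) • (s 1 - v • e) - (X 1 : MvPolynomial (Fin 3) k) •
          (s 0 - u • e) = ((X 0 : MvPolynomial (Fin 3) k) • s 1 -
          (X 1 : MvPolynomial (Fin 3) k) • s 0) - (X 0 * v - X 1 * u) • e := by module
      rw [this, hc, sub_self]
    intro i j
    fin_cases i <;> fin_cases j <;>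
      first | rfl | exact e12 | exact e12.symm | exact e20 | exact e20.symm | exact e01 |
        exact e01.symm)
  refine ⟨t, mul_left_cancel₀ (X_ne_zero (0 : Fin 3)) ?_⟩
  have h0 := congrArg π (ht 0)
  have hπe : π e = 0 := by
    rw [← LinearMap.mem_ker, hker]
    exact Submodule.mem_span_singleton_self e
  simpa [hs, hπe] using h0.symm

lemma exists_eq_X_smul {ι : Type*} (s : Fin 3 → ι → MvPolynomial (Fin 3) k)
    (hs : ∀ i j, (X j : MvPolynomial (Fin 3) k) • s i = (X i : MvPolynomial (Fin 3) k) • s j) :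
    ∃ t, ∀ i, s i = (X i : MvPolynomial (Fin 3) k) • t := by
  have h : ∀ l, ∃ a : MvPolynomial (Fin 3) k, (fun i => s i l) = a • X := fun l =>
    isPrimitiveVec_X.exists_eq_smul fun i j => by
      have := congrFun (hs i j) l
      simp only [Pi.smul_apply, smul_eq_mul] at this
      linear_combination this
  choose t ht using h
  refine ⟨t, fun i => funext fun l => ?_⟩
  have := congrFun (ht l) i
  simp only [Pi.smul_apply, smul_eq_mul] at this ⊢
  rw [this, mul_comm]

lemma exists_eq_X_smul_syz {f : MvPolynomial (Fin 3) k} (s : Fin 3 → syz f)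
    (hs : ∀ i j, (X j : MvPolynomial (Fin 3) k) • s i = (X i : MvPolynomial (Fin 3) k) • s j) :
    ∃ t, ∀ i, s i = (X i : MvPolynomial (Fin 3) k) • t := by
  obtain ⟨t, ht⟩ := exists_eq_X_smul (fun i => (s i : Fin 3 → MvPolynomial (Fin 3) k))
    fun i j => congrArg Subtype.val (hs i j)
  refine ⟨⟨t, ?_⟩, fun i => Subtype.ext (ht i)⟩
  have h0 := mem_syz_iff.1 (s 0).2
  rw [ht 0, smul_dotProduct, smul_eq_mul] at h0
  exact mem_syz_iff.2 ((mul_eq_zero.1 h0).resolve_left (X_ne_zero 0))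

end Saturated

/-! ### Heights and the projective Nullstellensatz -/

section Height

variable {k : Type*} [Field k]

lemma mem_idealOfVars_iff {σ : Type*} {p : MvPolynomial σ k} :
    p ∈ idealOfVars σ k ↔ coeff 0 p = 0 := by
  rw [← pow_one (idealOfVars σ k), mem_pow_idealOfVars_iff']
  simp only [Nat.lt_one_iff, Finsupp.degree_eq_zero_iff, forall_eq]

instance isMaximal_idealOfVars {σ : Type*} : (idealOfVars σ k).IsMaximal := by
  have : idealOfVars σ k = RingHom.ker (constantCoeff (σ := σ) (R := k)) := by
    ext p
    rw [mem_idealOfVars_iff, RingHom.mem_ker, constantCoeff_eq]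
  rw [this]
  exact RingHom.ker_isMaximal_of_surjective _ fun a => ⟨C a, constantCoeff_C _ a⟩

lemma mem_pow_idealOfVars_of_isHomogeneous {σ : Type*} {p : MvPolynomial σ k} {n N : ℕ}
    (hp : p.IsHomogeneous n) (hN : N ≤ n) : p ∈ idealOfVars σ k ^ N := by
  rw [mem_pow_idealOfVars_iff]
  intro x hx
  have : x.degree = n := by
    by_contra h
    exact mem_support_iff.1 hx (hp.coeff_eq_zero h)
  omega

/-- The projective Nullstellensatz: an ideal without zeros outside the origin contains a power of
the irrelevant ideal. -/
lemma exists_pow_idealOfVars_le {σ : Type*} [Finite σ] [IsAlgClosed k]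
    {I : Ideal (MvPolynomial σ k)}
    (h : ∀ p : σ → k, (∀ a ∈ I, eval p a = 0) → p = 0) : ∃ N, idealOfVars σ k ^ N ≤ I := by
  refine Ideal.exists_pow_le_of_le_radical_of_fg ?_ (idealOfVars_fg σ k)
  rw [← vanishingIdeal_zeroLocus_eq_radical (K := k) I, Ideal.span_le]
  rintro _ ⟨i, rfl⟩ p hp
  rw [h p fun a ha => by simpa [aeval_eq_eval] using hp a ha]
  simp

/-- The homogeneous prime ideal of the point `p` of projective space: the polynomials vanishing on
the line spanned by `p`. -/
def lineIdeal (p : Fin 3 → k) : Ideal (MvPolynomial (Fin 3) k) :=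
  RingHom.ker (aeval fun i => Polynomial.C (p i) * Polynomial.X :
    MvPolynomial (Fin 3) k →ₐ[k] Polynomial k)

instance isPrime_lineIdeal (p : Fin 3 → k) : (lineIdeal p).IsPrime := RingHom.ker_isPrime _

lemma X_mem_lineIdeal_iff {p : Fin 3 → k} {i : Fin 3} : X i ∈ lineIdeal p ↔ p i = 0 := by
  simp [lineIdeal, RingHom.mem_ker]

lemma mem_lineIdeal_of_isHomogeneous {p : Fin 3 → k} {a : MvPolynomial (Fin 3) k} {n : ℕ}
    (ha : a.IsHomogeneous n) (hp : eval p a = 0) : a ∈ lineIdeal p := by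
  have h : (aeval fun i => Polynomial.C (p i) * Polynomial.X :
      MvPolynomial (Fin 3) k →ₐ[k] Polynomial k) a =
      Polynomial.C (eval p a) * Polynomial.X ^ n := by
    rw [aeval_def, eval₂_eq', eval_eq', map_sum, Finset.sum_mul]
    refine Finset.sum_congr rfl fun m hm => ?_
    have hmn : ∑ i, m i = n := by
      rw [← Finsupp.degree_eq_sum]
      by_contra h
      exact mem_support_iff.1 hm (ha.coeff_eq_zero h)
    simp only [mul_pow, Finset.prod_mul_distrib, Finset.prod_pow_eq_pow_sum, hmn, map_mul,
      map_prod, map_pow, Polynomial.algebraMap_eq, mul_assoc]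
  rw [lineIdeal, RingHom.mem_ker, h, hp, map_zero, zero_mul]

lemma lineIdeal_lt {p : Fin 3 → k} (hp : p ≠ 0) : lineIdeal p < idealOfVars (Fin 3) k := by
  obtain ⟨i, hi⟩ := Function.ne_iff.1 hp
  refine lt_of_le_of_ne (fun a ha => ?_) fun h => hi (X_mem_lineIdeal_iff.1 ?_)
  · have h1 := congrArg (Polynomial.eval 0) (RingHom.mem_ker.1 ha)
    have h2 : (Polynomial.aeval (0 : k)).comp (aeval fun i => Polynomial.C (p i) * Polynomial.X) =
        (aeval 0 : MvPolynomial (Fin 3) k →ₐ[k] k) := by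
      ext i
      simp
    have h3 := congrArg (fun φ => φ a) h2
    simp only [AlgHom.comp_apply, aeval_zero, Polynomial.coe_aeval_eq_eval] at h3
    rw [mem_idealOfVars_iff, ← constantCoeff_eq]
    exact h3.symm.trans (h1.trans Polynomial.eval_zero)
  · rw [h]
    exact Ideal.subset_span ⟨i, rfl⟩

/-- In a factorial domain, a prime ideal containing the coordinates of a primitive vector has
height at least two: it properly contains the ideal generated by one of its prime elements. -/
lemma two_le_height_of_isPrimitiveVec {ι A : Type*} [CommRing A] [IsDomain A]
    [UniqueFactorizationMonoid A] [IsNoetherianRing A] {v : ι → A} (hv : IsPrimitiveVec v)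
    {P : Ideal A} [hP : P.IsPrime] (hvP : ∀ i, v i ∈ P) : 2 ≤ P.height := by
  obtain ⟨i, hi⟩ := Function.ne_iff.1 hv.1
  obtain ⟨q, hqP, hq⟩ := hP.exists_mem_prime_of_ne_bot (fun h => hi (by simpa [h] using hvP i))
  have hQ : (Ideal.span {q}).IsPrime := (Ideal.span_singleton_prime hq.ne_zero).2 hq
  have h1 : (⊥ : Ideal A) < Ideal.span {q} := by
    rw [bot_lt_iff_ne_bot, Ne, Ideal.span_singleton_eq_bot]
    exact hq.ne_zero
  have h2 : Ideal.span {q} < P := by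
    refine lt_of_le_of_ne ((Ideal.span_singleton_le_iff_mem _).2 hqP) fun h => ?_
    obtain ⟨j, hj⟩ := hv.2 q hq
    exact hj (Ideal.mem_span_singleton.1 (h ▸ hvP j))
  have h3 := Order.add_one_le_of_lt (Ideal.height_strict_mono_of_isPrime h1)
  have h4 := Order.add_one_le_of_lt (Ideal.height_strict_mono_of_isPrime h2)
  calc (2 : ℕ∞) = 0 + 1 + 1 := by norm_num
    _ ≤ (⊥ : Ideal A).height + 1 + 1 := by gcongr; exact bot_le
    _ ≤ P.height := (add_le_add_left h3 1).trans h4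

lemma height_idealOfVars : (idealOfVars (Fin 3) k).height = 3 := by
  apply le_antisymm
  · have h := Ideal.height_le_ringKrullDim_of_isPrime (I := idealOfVars (Fin 3) k)
    rw [MvPolynomial.ringKrullDim_of_isNoetherianRing, ringKrullDim_eq_zero_of_field] at h
    simp only [Nat.card_eq_fintype_card, Fintype.card_fin, zero_add] at h
    exact WithBot.coe_le_coe.1 h
  · -- The ideal of the point `(0 : 0 : 1)` contains the primitive vector `(x₀, x₁)`.
    let p : Fin 3 → k := Pi.single 2 1
    have hp : p ≠ 0 := by simp [p]
    let v : Fin 2 → MvPolynomial (Fin 3) k := ![X 0, X 1]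
    have hv : IsPrimitiveVec v := by
      refine ⟨Function.ne_iff.2 ⟨0, X_ne_zero 0⟩, fun q hq => ?_⟩
      by_contra! h
      have h01 : (X 0 : MvPolynomial (Fin 3) k) ∣ X 1 :=
        (hq.associated_of_dvd (X_prime (i := 0)) (h 0)).symm.dvd.trans (h 1)
      exact absurd (X_dvd_X.1 h01) (by simp)
    have h2 : 2 ≤ (lineIdeal p).height := two_le_height_of_isPrimitiveVec hv fun i => by
      fin_cases i
      · exact X_mem_lineIdeal_iff.2 (by simp [p])
      · exact X_mem_lineIdeal_iff.2 (by simp [p])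
    calc (3 : ℕ∞) = 2 + 1 := by norm_num
      _ ≤ (lineIdeal p).height + 1 := by gcongr
      _ ≤ _ := Order.add_one_le_of_lt (Ideal.height_strict_mono_of_isPrime (lineIdeal_lt hp))

attribute [local instance] MvPolynomial.gradedAlgebra in
/-- A homogeneous saturated ideal containing the coordinates of a primitive vector is the unit
ideal or has codimension two: if it has no zero in the projective plane, it contains a power of the
irrelevant ideal; otherwise it is contained in the prime ideal of a point. -/
lemma eq_top_or_height_eq_two [IsAlgClosed k] {I : Ideal (MvPolynomial (Fin 3) k)}
    (hhom : I.IsHomogeneous (homogeneousSubmodule (Fin 3) k)) (hsat : IsSaturated I)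
    {ι : Type*} {v : ι → MvPolynomial (Fin 3) k} (hv : IsPrimitiveVec v) (hvI : ∀ i, v i ∈ I) :
    I = ⊤ ∨ I.height = 2 := by
  by_cases h : ∀ p : Fin 3 → k, (∀ a ∈ I, eval p a = 0) → p = 0
  · obtain ⟨N, hN⟩ := exists_pow_idealOfVars_le h
    exact Or.inl (hsat.eq_top_of_pow_le hN)
  · push Not at h
    obtain ⟨p, hp, hp0⟩ := h
    refine Or.inr (le_antisymm ?_ ?_)
    · have hle : I ≤ lineIdeal p := by
        intro a ha
        rw [← sum_homogeneousComponent a]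
        exact Ideal.sum_mem _ fun n _ => mem_lineIdeal_of_isHomogeneous
          (homogeneousComponent_isHomogeneous n a)
          (hp _ (homogeneousComponent_mem_of_mem hhom ha n))
      have h1 := Order.add_one_le_of_lt (Ideal.height_strict_mono_of_isPrime (lineIdeal_lt hp0))
      rw [height_idealOfVars] at h1
      have h2 : (lineIdeal p).height ≤ 2 := by
        rw [show (3 : ℕ∞) = 2 + 1 by norm_num] at h1
        exact (ENat.add_le_add_iff_right ENat.one_ne_top).1 h1
      exact (Ideal.height_mono hle).trans h2
    · rw [Ideal.height_eq_inf_minimalPrimes]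
      refine le_iInf₂ fun P hP => ?_
      have := hP.isPrime
      exact two_le_height_of_isPrimitiveVec hv fun i => hP.1.2 (hvI i)

end Height

/-! ### Smooth curves: the gradient as a regular sequence -/

section Smooth

open Matrix

variable {k : Type*} [Field k]

/-- Two of three homogeneous polynomials of positive degree without common zero in the projective
plane have no common factor `q`: a minimal prime over `q` and the third polynomial has height at
most two by Krull's theorem, but it is the irrelevant ideal, of height three. -/
lemma not_dvd_of_pow_le {g : Fin 3 → MvPolynomial (Fin 3) k} {N : ℕ}
    (hN : idealOfVars (Fin 3) k ^ N ≤ Ideal.span (Set.range g)) (hg2 : g 2 ∈ idealOfVars (Fin 3) k)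
    {q : MvPolynomial (Fin 3) k} (hq : q ∈ idealOfVars (Fin 3) k) (h0 : q ∣ g 0) : ¬ q ∣ g 1 := by
  classical
  intro h1
  have hle : Ideal.span (({q, g 2} : Finset _) : Set (MvPolynomial (Fin 3) k)) ≤
      idealOfVars (Fin 3) k := by
    rw [Ideal.span_le]
    intro a ha
    simp only [Finset.coe_insert, Finset.coe_singleton, Set.mem_insert_iff,
      Set.mem_singleton_iff] at ha
    rcases ha with rfl | rfl
    · exact hq
    · exact hg2
  obtain ⟨P, hP, -⟩ := Ideal.exists_minimalPrimes_le hle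
  have hPp := hP.isPrime
  have hqP : q ∈ P := hP.1.2 (Ideal.subset_span (by simp))
  have hgP : Ideal.span (Set.range g) ≤ P := by
    rw [Ideal.span_le]
    rintro _ ⟨i, rfl⟩
    fin_cases i
    · exact P.mem_of_dvd h0 hqP
    · exact P.mem_of_dvd h1 hqP
    · exact hP.1.2 (Ideal.subset_span (by simp))
  have h3 := Ideal.height_mono (hPp.le_of_pow_le (hN.trans hgP))
  rw [height_idealOfVars] at h3
  have h2 := (h3.trans (Ideal.height_le_card_of_mem_minimalPrimes_span_finset hP)).trans
    (Nat.cast_le.2 Finset.card_le_two)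
  exact absurd h2 (by decide)

lemma isHomogeneous_mem_idealOfVars {σ : Type*} {p : MvPolynomial σ k} {d : ℕ} (hd : 0 < d)
    (hp : p.IsHomogeneous d) : p ∈ idealOfVars σ k := by
  simpa using mem_pow_idealOfVars_of_isHomogeneous hp (N := 1) hd

variable {g : Fin 3 → MvPolynomial (Fin 3) k} {d N : ℕ}

lemma isPrimitiveVec_pair (hd : 0 < d) (hg : ∀ i, (g i).IsHomogeneous d)
    (hN : idealOfVars (Fin 3) k ^ N ≤ Ideal.span (Set.range g)) : IsPrimitiveVec ![g 0, g 1] := by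
  have hgm := fun i => isHomogeneous_mem_idealOfVars hd (hg i)
  have h0 : g 0 ≠ 0 := fun h =>
    not_dvd_of_pow_le hN (hgm 2) (hgm 1) (h ▸ dvd_zero _) dvd_rfl
  refine ⟨Function.ne_iff.2 ⟨0, h0⟩, fun q hq => ?_⟩
  by_contra! h
  refine not_dvd_of_pow_le hN (hgm 2) ?_ (h 0) (h 1)
  exact mem_idealOfVars_iff.2 (coeff_zero_of_prime_dvd hq h0 (hg 0) (h 0))

lemma exists_eq_of_mul_add_mul_eq_zero {A : Type*} [CommRing A] [IsDomain A]
    [UniqueFactorizationMonoid A] {a b u v : A} (hab : IsPrimitiveVec ![a, b])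
    (h : u * a + v * b = 0) : ∃ c, u = c * b ∧ v = -(c * a) := by
  obtain ⟨c, hc⟩ := hab.exists_eq_smul (u := ![v, -u]) fun i j => by
    fin_cases i <;> fin_cases j <;> simp
    · linear_combination h
    · linear_combination -h
  refine ⟨-c, ?_, ?_⟩
  · have := congrFun hc 1
    simp at this
    linear_combination -this
  · have := congrFun hc 0
    simp at this
    linear_combination this

/-- The complete intersection ideal of two coprime polynomials is saturated. -/
lemma isSaturated_span_pair {a b : MvPolynomial (Fin 3) k} (hab : IsPrimitiveVec ![a, b]) :
    IsSaturated (Ideal.span {a, b}) := by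
  have hrange : LinearMap.range (Fintype.linearCombination (MvPolynomial (Fin 3) k) ![a, b]) =
      Ideal.span {a, b} := by
    rw [Fintype.range_linearCombination, Matrix.range_cons_cons_empty]
  rw [← hrange]
  refine isSaturated_range _ ![b, -a] ?_ ?_ fun s hs => exists_eq_X_smul s hs
  · ext s
    rw [LinearMap.mem_ker, Submodule.mem_span_singleton, Fintype.linearCombination_apply,
      Fin.sum_univ_two]
    simp only [cons_val_zero, cons_val_one, smul_eq_mul]
    constructor
    · intro h
      obtain ⟨c, h0, h1⟩ := exists_eq_of_mul_add_mul_eq_zero hab h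
      refine ⟨c, funext fun i => ?_⟩
      fin_cases i
      · simp [h0]
      · simp [h1]
    · rintro ⟨c, rfl⟩
      simp
      ring
  · intro c hc
    by_contra hne
    refine hab.1 (funext fun i => ?_)
    have h0 := congrFun hc 0
    have h1 := congrFun hc 1
    simp [hne] at h0 h1
    fin_cases i
    · simpa using h1
    · simpa using h0

lemma mem_span_pair_of_mul_mem (hd : 0 < d) (hg : ∀ i, (g i).IsHomogeneous d)
    (hN : idealOfVars (Fin 3) k ^ N ≤ Ideal.span (Set.range g)) {a : MvPolynomial (Fin 3) k}
    (ha : g 2 * a ∈ Ideal.span {g 0, g 1}) : a ∈ Ideal.span {g 0, g 1} := by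
  refine (isSaturated_span_pair (isPrimitiveVec_pair hd hg hN)).mem_of_mul_mem (N := N) ?_ ha
  refine hN.trans (Ideal.span_le.2 ?_)
  rintro _ ⟨i, rfl⟩
  fin_cases i
  · exact Ideal.mem_sup_left (Ideal.subset_span (by simp))
  · exact Ideal.mem_sup_left (Ideal.subset_span (by simp))
  · exact Ideal.mem_sup_right (Ideal.subset_span (by simp))

lemma isSMulRegular_quotient_of_mem {A : Type*} [CommRing A] {I : Ideal A} {r : A}
    (h : ∀ a, r * a ∈ I → a ∈ I) : IsSMulRegular (A ⧸ (I • ⊤ : Submodule A A)) r := by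
  rw [isSMulRegular_iff_right_eq_zero_of_smul]
  intro x hx
  obtain ⟨a, rfl⟩ := Submodule.Quotient.mk_surjective _ x
  rw [← Submodule.Quotient.mk_smul, Submodule.Quotient.mk_eq_zero] at hx
  rw [Submodule.Quotient.mk_eq_zero]
  simp only [smul_eq_mul, Ideal.mul_top] at hx ⊢
  exact h a hx

/-- Three forms of the same positive degree without common zero in the projective plane are a
regular sequence: the first two are coprime, and the ideal they generate is saturated. -/
lemma isRegular_of_pow_le (hd : 0 < d) (hg : ∀ i, (g i).IsHomogeneous d)
    (hN : idealOfVars (Fin 3) k ^ N ≤ Ideal.span (Set.range g)) :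
    RingTheory.Sequence.IsRegular (MvPolynomial (Fin 3) k) [g 0, g 1, g 2] := by
  have hp := isPrimitiveVec_pair hd hg hN
  have hgm := fun i => isHomogeneous_mem_idealOfVars hd (hg i)
  have h0 : g 0 ≠ 0 := fun h =>
    not_dvd_of_pow_le hN (hgm 2) (hgm 1) (h ▸ dvd_zero _) dvd_rfl
  refine ⟨⟨fun i hi => ?_⟩, fun h => ?_⟩
  · refine isSMulRegular_quotient_of_mem fun a ha => ?_
    have hi3 : i < 3 := hi
    interval_cases i
    · simpa [h0] using ha
    · simp only [List.take_succ_cons, List.take_zero, List.getElem_cons_succ,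
        List.getElem_cons_zero, Ideal.ofList_singleton] at ha ⊢
      obtain ⟨b, hb⟩ := Ideal.mem_span_singleton.1 ha
      obtain ⟨c, -, hc⟩ := exists_eq_of_mul_add_mul_eq_zero hp (u := -b) (v := a)
        (by linear_combination hb)
      rw [hc, Ideal.mem_span_singleton]
      exact ⟨-c, by ring⟩
    · simp only [List.take_succ_cons, List.take_zero, List.getElem_cons_succ,
        List.getElem_cons_zero, Ideal.ofList_cons, Ideal.ofList_nil, sup_bot_eq,
        ← Ideal.span_insert] at ha ⊢
      exact mem_span_pair_of_mul_mem hd hg hN ha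
  · rw [smul_eq_mul, Ideal.mul_top] at h
    refine (isMaximal_idealOfVars (k := k) (σ := Fin 3)).ne_top (top_le_iff.1 (h.le.trans ?_))
    rw [Ideal.ofList, Ideal.span_le]
    intro a ha
    simp only [List.mem_cons, List.not_mem_nil, or_false, Set.mem_ofPred] at ha
    rcases ha with rfl | rfl | rfl <;> exact hgm _

variable {f : MvPolynomial (Fin 3) k}

/-- The last coordinate of a syzygy lies in `(g₀, g₁)` by regularity of the gradient `g`, so Koszul
syzygies can be subtracted until it vanishes; what remains is a multiple of the syzygy of
`g₀, g₁`. -/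
lemma syz_eq_span_koszul (hd : 0 < d) (hf : f.IsHomogeneous (d + 1))
    (hN : idealOfVars (Fin 3) k ^ N ≤ Ideal.span (Set.range (grad f))) :
    syz f = Submodule.span (MvPolynomial (Fin 3) k)
      (Set.range fun ij : Fin 3 × Fin 3 => koszul f ij.1 ij.2) := by
  have hg := grad_isHomogeneous hf
  apply le_antisymm
  · intro s hs
    have hs' := mem_syz_iff.1 hs
    rw [vec3_dotProduct] at hs'
    have h2 : s 2 ∈ Ideal.span {grad f 0, grad f 1} := by
      refine mem_span_pair_of_mul_mem hd hg hN (Ideal.mem_span_pair.2 ⟨-s 0, -s 1, ?_⟩)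
      linear_combination -hs'
    obtain ⟨a, b, hab⟩ := Ideal.mem_span_pair.1 h2
    obtain ⟨c, h0, h1⟩ := exists_eq_of_mul_add_mul_eq_zero (isPrimitiveVec_pair hd hg hN)
      (u := s 0 + a * grad f 2) (v := s 1 + b * grad f 2)
      (by linear_combination hs' + grad f 2 * hab)
    have hsum : s = a • koszul f 2 0 + b • koszul f 2 1 + c • koszul f 0 1 := by
      funext i
      simp only [grad] at h0 h1 hab
      fin_cases i
      · simp [koszul]
        linear_combination h0
      · simp [koszul]
        linear_combination h1
      · simp [koszul]
        linear_combination -hab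
    have hk : ∀ i j, koszul f i j ∈ Submodule.span (MvPolynomial (Fin 3) k)
        (Set.range fun ij : Fin 3 × Fin 3 => koszul f ij.1 ij.2) := fun i j =>
      Submodule.subset_span ⟨(i, j), rfl⟩
    rw [hsum]
    exact add_mem (add_mem (Submodule.smul_mem _ _ (hk _ _)) (Submodule.smul_mem _ _ (hk _ _)))
      (Submodule.smul_mem _ _ (hk _ _))
  · rw [Submodule.span_le]
    rintro _ ⟨ij, rfl⟩
    exact koszul_mem_syz f _ _

lemma homogeneousComponent_eq_zero_of_mem_span {a : MvPolynomial (Fin 3) k}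
    (hg : ∀ i, (g i).IsHomogeneous d) (ha : a ∈ Ideal.span (Set.range g)) {n : ℕ} (hn : n < d) :
    homogeneousComponent n a = 0 := by
  obtain ⟨c, rfl⟩ := Ideal.mem_span_range_iff_exists_fun.1 ha
  rw [map_sum]
  exact Finset.sum_eq_zero fun i _ => homogeneousComponent_mul_of_lt (hg i) _ hn

/-- The coordinates of a combination of Koszul syzygies lie in the Jacobian ideal, which is
generated in degree `d`. -/
lemma le_indeg (hf : f.IsHomogeneous (d + 1)) (hg0 : grad f ≠ 0)
    (hsyz : syz f = Submodule.span (MvPolynomial (Fin 3) k)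
      (Set.range fun ij : Fin 3 × Fin 3 => koszul f ij.1 ij.2)) : d ≤ indeg f := by
  obtain ⟨ε, hε⟩ := exists_isInitialSyzygy hf hg0
  by_contra! hlt
  have hmem : ∀ s ∈ syz f, ∀ i, s i ∈ Ideal.span (Set.range (grad f)) := by
    intro s hs
    rw [hsyz] at hs
    induction hs using Submodule.span_induction with
    | mem s hs =>
      obtain ⟨⟨a, b⟩, rfl⟩ := hs
      intro i
      simp only [koszul, Pi.sub_apply, Pi.single_apply]
      refine sub_mem ?_ ?_
      · split_ifs
        · exact Ideal.subset_span ⟨b, rfl⟩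
        · exact zero_mem _
      · split_ifs
        · exact Ideal.subset_span ⟨a, rfl⟩
        · exact zero_mem _
    | zero => exact fun i => zero_mem _
    | add s t _ _ hs ht => exact fun i => add_mem (hs i) (ht i)
    | smul a s _ hs => exact fun i => Ideal.mul_mem_left _ a (hs i)
  refine hε.1 (Subtype.ext (funext fun i => ?_))
  rw [← homogeneousComponent_eq_self (hε.2 i)]
  exact homogeneousComponent_eq_zero_of_mem_span (grad_isHomogeneous hf) (hmem _ ε.2 i) hlt

/-- By Euler's identity, a curve is smooth if and only if the partial derivatives have no common
zero in the projective plane. -/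
lemma isSmooth_iff (hchar : ((d + 1 : ℕ) : k) ≠ 0) (hf : f.IsHomogeneous (d + 1)) :
    IsSmooth f ↔ ∀ p : Fin 3 → k, (∀ i, eval p (grad f i) = 0) → p = 0 := by
  constructor
  · intro h p hp
    by_contra hp0
    have hE := congrArg (eval p) (sum_X_mul_grad hf)
    simp only [map_sum, map_mul, hp, mul_zero, Finset.sum_const_zero, eval_C] at hE
    obtain ⟨i, hi⟩ := h p hp0 ((mul_eq_zero.1 hE.symm).resolve_left hchar)
    exact hi (hp i)
  · intro h p hp0 _
    by_contra! hall
    exact hp0 (h p hall)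

lemma isSmooth_iff_exists_pow_le [IsAlgClosed k] (hchar : ((d + 1 : ℕ) : k) ≠ 0)
    (hf : f.IsHomogeneous (d + 1)) :
    IsSmooth f ↔ ∃ N, idealOfVars (Fin 3) k ^ N ≤ Ideal.span (Set.range (grad f)) := by
  rw [isSmooth_iff hchar hf]
  constructor
  · intro h
    exact exists_pow_idealOfVars_le fun p hp => h p fun i => hp _ (Ideal.subset_span ⟨i, rfl⟩)
  · rintro ⟨N, hN⟩ p hp
    have hker : Ideal.span (Set.range (grad f)) ≤ RingHom.ker (eval p) := by
      rw [Ideal.span_le]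
      rintro _ ⟨i, rfl⟩
      exact hp i
    funext i
    have hX : (X i : MvPolynomial (Fin 3) k) ∈ idealOfVars (Fin 3) k :=
      Ideal.subset_span (Set.mem_range_self i)
    have h1 := hker (hN (Ideal.pow_mem_pow hX N))
    rw [RingHom.mem_ker, map_pow, eval_X] at h1
    exact eq_zero_of_pow_eq_zero h1

end Smooth

/-! ### Hilbert functions -/

section Hilbert

variable {k : Type*} [Field k]

instance finite_homogeneousSubmodule {σ : Type*} [Finite σ] (n : ℕ) :
    Module.Finite k (homogeneousSubmodule σ k n) :=
  Module.Finite.iff_fg.2 (homogeneousSubmodule_fg σ k n)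

lemma finrank_homogeneousSubmodule (n : ℕ) :
    2 * Module.finrank k (homogeneousSubmodule (Fin 3) k n) = (n + 1) * (n + 2) := by
  classical
  have hset : {m : Fin 3 →₀ ℕ | m.degree = n} =
      ((Finset.univ : Finset (Fin 3)).finsuppAntidiag n : Set (Fin 3 →₀ ℕ)) := by
    ext m
    simp [Finset.mem_finsuppAntidiag, Finsupp.degree_eq_sum]
  have h : Module.finrank k (homogeneousSubmodule (Fin 3) k n) = (n + 2).choose 2 := by
    rw [homogeneousSubmodule_eq_finsupp_supported]
    refine (Module.finrank_eq_nat_card_basis (basisRestrictSupport k _)).trans ?_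
    rw [hset, Nat.card_eq_card_toFinset, Finset.toFinset_coe,
      Finset.card_finsuppAntidiag_nat_eq_choose, Finset.card_univ, Fintype.card_fin,
      show 3 + n - 1 = n + 2 by omega, Nat.choose_symm_add]
  rw [h, Nat.choose_two_right, Nat.mul_div_cancel' (Nat.even_mul_pred_self _).two_dvd]
  simp [mul_comm]

lemma finrank_map_add_finrank_inf_ker {V W : Type*} [AddCommGroup V] [Module k V]
    [AddCommGroup W] [Module k W] (S : Submodule k V) [FiniteDimensional k S] (φ : V →ₗ[k] W) :
    Module.finrank k (S.map φ) + Module.finrank k (S ⊓ LinearMap.ker φ : Submodule k V) =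
      Module.finrank k S := by
  have h := (φ.domRestrict S).finrank_range_add_finrank_ker
  rw [LinearMap.range_domRestrict] at h
  rw [← h, LinearMap.ker_domRestrict, inf_comm, ← Submodule.finrank_map_subtype_eq,
    Submodule.map_comap_subtype, inf_comm]

lemma hilbertFunction_add_finrank (I : Ideal (MvPolynomial (Fin 3) k)) (n : ℕ) :
    hilbertFunction I n +
      Module.finrank k (homogeneousSubmodule (Fin 3) k n ⊓ I.restrictScalars k : Submodule k _) =
      Module.finrank k (homogeneousSubmodule (Fin 3) k n) := by
  have hker : LinearMap.ker (Ideal.Quotient.mkₐ k I).toLinearMap = I.restrictScalars k := by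
    ext a
    simp [Ideal.Quotient.eq_zero_iff_mem]
  have h := finrank_map_add_finrank_inf_ker (homogeneousSubmodule (Fin 3) k n)
    (Ideal.Quotient.mkₐ k I).toLinearMap
  rwa [hker] at h

lemma hilbertFunction_eq_zero_iff {I : Ideal (MvPolynomial (Fin 3) k)} {n : ℕ} :
    hilbertFunction I n = 0 ↔ ∀ a : MvPolynomial (Fin 3) k, a.IsHomogeneous n → a ∈ I := by
  have h := hilbertFunction_add_finrank I n
  constructor
  · intro h0 a ha
    rw [h0, zero_add] at h
    have := Submodule.eq_of_le_of_finrank_eq inf_le_left h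
    rw [inf_eq_left] at this
    exact this ha
  · intro hall
    have : homogeneousSubmodule (Fin 3) k n ⊓ I.restrictScalars k =
        homogeneousSubmodule (Fin 3) k n := inf_eq_left.2 hall
    rw [this] at h
    omega

/-- If the Hilbert function of `R / I` vanishes in all large degrees, then `I` contains a power of
the irrelevant ideal. -/
lemma exists_pow_le_of_hilbertFunction {I : Ideal (MvPolynomial (Fin 3) k)} {N : ℕ}
    (h : ∀ n, N ≤ n → hilbertFunction I n = 0) : ∃ N, idealOfVars (Fin 3) k ^ N ≤ I := by
  refine ⟨N, fun a ha => ?_⟩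
  rw [← sum_homogeneousComponent a]
  refine Ideal.sum_mem _ fun n _ => ?_
  by_cases hn : N ≤ n
  · exact hilbertFunction_eq_zero_iff.1 (h n hn) _ (homogeneousComponent_isHomogeneous n a)
  · have : homogeneousComponent n a = 0 := by
      refine homogeneousComponent_eq_zero' _ _ fun m hm hmn => ?_
      have := (mem_pow_idealOfVars_iff N a).1 ha m hm
      omega
    rw [this]
    exact zero_mem _

lemma hilbertFunction_eq_zero_of_pow_le {I : Ideal (MvPolynomial (Fin 3) k)} {N : ℕ}
    (h : idealOfVars (Fin 3) k ^ N ≤ I) {n : ℕ} (hn : N ≤ n) : hilbertFunction I n = 0 :=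
  hilbertFunction_eq_zero_iff.2 fun _ ha => h (mem_pow_idealOfVars_of_isHomogeneous ha hn)

/-- Some linear form is a nonzerodivisor modulo a given saturated ideal: the irrelevant ideal is
not associated to it, and a vector space over an infinite field is not a finite union of proper
subspaces. -/
lemma IsSaturated.exists_linearForm [Infinite k] {I : Ideal (MvPolynomial (Fin 3) k)}
    (hI : IsSaturated I) :
    ∃ l : MvPolynomial (Fin 3) k, l.IsHomogeneous 1 ∧ ∀ a, l * a ∈ I → a ∈ I := by
  let R := MvPolynomial (Fin 3) k
  have hfin : (associatedPrimes R (R ⧸ I)).Finite := associatedPrimes.finite R (R ⧸ I)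
  have : Finite (associatedPrimes R (R ⧸ I)) := hfin
  let W : associatedPrimes R (R ⧸ I) → Subspace k (homogeneousSubmodule (Fin 3) k 1) := fun P =>
    ((P : Ideal R).restrictScalars k).comap (homogeneousSubmodule (Fin 3) k 1).subtype
  have hzd := biUnion_associatedPrimes_eq_zero_divisors R (R ⧸ I)
  have hcov : (⋃ P, (W P : Set (homogeneousSubmodule (Fin 3) k 1))) ≠ Set.univ := by
    intro hcov
    obtain ⟨⟨P, hP⟩, htop⟩ := Subspace.exists_eq_top_of_iUnion_eq_univ hcov
    have hX : ∀ i, X i ∈ P := fun i => by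
      have : (⟨X i, isHomogeneous_X k i⟩ : homogeneousSubmodule (Fin 3) k 1) ∈ W ⟨P, hP⟩ :=
        htop ▸ Submodule.mem_top
      exact this
    obtain ⟨hprime, x, rfl⟩ := (isAssociatedPrime_iff).1 (AssociatedPrimes.mem_iff.1 hP)
    obtain ⟨a, rfl⟩ := Ideal.Quotient.mk_surjective x
    have haI : a ∈ I := hI a fun i => by
      have h1 := hX i
      rw [Submodule.mem_colon_singleton, Submodule.mem_bot] at h1
      exact Ideal.Quotient.eq_zero_iff_mem.1 h1
    refine hprime.ne_top ?_
    rw [Ideal.Quotient.eq_zero_iff_mem.2 haI]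
    simp
  obtain ⟨l, hl⟩ := (Set.ne_univ_iff_exists_notMem _).1 hcov
  refine ⟨l, l.2, fun a ha => ?_⟩
  by_contra haI
  have hmem : (l : R) ∈ {r : R | ∃ x : R ⧸ I, x ≠ 0 ∧ r • x = 0} :=
    ⟨Ideal.Quotient.mk I a, fun h => haI (Ideal.Quotient.eq_zero_iff_mem.1 h),
      Ideal.Quotient.eq_zero_iff_mem.2 ha⟩
  rw [← hzd] at hmem
  obtain ⟨P, hP, hlP⟩ := Set.mem_iUnion₂.1 hmem
  exact hl (Set.mem_iUnion.2 ⟨⟨P, hP⟩, hlP⟩)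

lemma IsSaturated.monotone_hilbertFunction [Infinite k] {I : Ideal (MvPolynomial (Fin 3) k)}
    (hI : IsSaturated I) : Monotone (hilbertFunction I) := by
  obtain ⟨l, hl, hreg⟩ := hI.exists_linearForm
  refine monotone_nat_of_le_succ fun n => ?_
  let μ : (MvPolynomial (Fin 3) k ⧸ I) →ₗ[k] (MvPolynomial (Fin 3) k ⧸ I) :=
    LinearMap.mulLeft k (Ideal.Quotient.mk I l)
  have hμ : Function.Injective μ := by
    rw [← LinearMap.ker_eq_bot, LinearMap.ker_eq_bot']
    intro x hx
    obtain ⟨a, rfl⟩ := Ideal.Quotient.mk_surjective x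
    rw [LinearMap.mulLeft_apply, ← map_mul, Ideal.Quotient.eq_zero_iff_mem] at hx
    exact Ideal.Quotient.eq_zero_iff_mem.2 (hreg a hx)
  rw [hilbertFunction, hilbertFunction,
    (Submodule.equivMapOfInjective μ hμ _).finrank_eq]
  refine Submodule.finrank_mono ?_
  rintro _ ⟨_, ⟨a, ha, rfl⟩, rfl⟩
  refine ⟨l * a, ?_, map_mul (Ideal.Quotient.mk I) l a⟩
  have := hl.mul ha
  rwa [add_comm] at this

lemma exists_eventually_eq_of_monotone {H : ℕ → ℕ} (hH : Monotone H) {M B : ℕ}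
    (hB : ∀ m, M ≤ m → H m ≤ B) : ∃ N v, ∀ m, N ≤ m → H m = v := by
  -- The largest value is attained, and is kept from then on.
  have hbdd : BddAbove (Set.range H) := by
    refine ⟨B, ?_⟩
    rintro _ ⟨m, rfl⟩
    exact (hH (le_max_left m M)).trans (hB _ (le_max_right m M))
  obtain ⟨N, hN⟩ := Nat.sSup_mem (Set.range_nonempty H) hbdd
  refine ⟨N, H N, fun m hm => le_antisymm ?_ (hH hm)⟩
  rw [hN]
  exact le_csSup hbdd ⟨m, rfl⟩

lemma hilbertPolynomial_of_eventually {I : Ideal (MvPolynomial (Fin 3) k)} {N v : ℕ}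
    (h : ∀ n, N ≤ n → hilbertFunction I n = v) :
    hilbertPolynomial I = Polynomial.C (v : ℚ) := by
  have hex : ∃ P : Polynomial ℚ, ∀ᶠ n : ℕ in atTop, (hilbertFunction I n : ℚ) = P.eval (n : ℚ) :=
    ⟨Polynomial.C (v : ℚ), by
      filter_upwards [eventually_ge_atTop N] with n hn
      rw [h n hn, Polynomial.eval_C]⟩
  rw [hilbertPolynomial, dif_pos hex]
  obtain ⟨M, hM⟩ := eventually_atTop.1 hex.choose_spec
  refine Polynomial.eq_of_infinite_eval_eq _ _ ?_
  refine Set.Infinite.mono (s := (fun n : ℕ => (n : ℚ)) '' Set.Ici (max M N)) ?_ ?_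
  · rintro _ ⟨n, hn, rfl⟩
    have hn' : max M N ≤ n := hn
    rw [Set.mem_ofPred, ← hM n (by omega), h n (by omega), Polynomial.eval_C]
  · exact (Set.Ici_infinite _).image Nat.cast_injective.injOn

lemma quotientDegree_of_eventually {I : Ideal (MvPolynomial (Fin 3) k)} {N v : ℕ}
    (h : ∀ n, N ≤ n → hilbertFunction I n = v) (hv : v ≠ 0) : quotientDegree I = v := by
  rw [quotientDegree, hilbertPolynomial_of_eventually h, if_neg (by simpa using hv),
    Polynomial.natDegree_C, Polynomial.leadingCoeff_C, Nat.factorial_zero, Nat.cast_one, one_mul]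

lemma quotientDegree_top : quotientDegree (⊤ : Ideal (MvPolynomial (Fin 3) k)) = 0 := by
  have h : ∀ n, hilbertFunction (⊤ : Ideal (MvPolynomial (Fin 3) k)) n = 0 := fun n =>
    hilbertFunction_eq_zero_iff.2 fun _ _ => Submodule.mem_top
  rw [quotientDegree, hilbertPolynomial_of_eventually (N := 0) (v := 0) fun n _ => h n,
    if_pos (by simp)]
  simp [h]

open Classical in
lemma quotientDegree_congr {I J : Ideal (MvPolynomial (Fin 3) k)}
    (h : hilbertFunction I = hilbertFunction J) : quotientDegree I = quotientDegree J := by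
  have hP : hilbertPolynomial I = hilbertPolynomial J :=
    congrArg (fun H : ℕ → ℕ =>
      if h : ∃ P : Polynomial ℚ, ∀ᶠ n : ℕ in atTop, (H n : ℚ) = P.eval (n : ℚ)
      then h.choose else 0) h
  rw [quotientDegree, quotientDegree, hP, h]

end Hilbert

/-! ### The Hilbert function of a Bourbaki ideal -/

section BourbakiHilbert

open Matrix

variable {k : Type*} [Field k] {f : MvPolynomial (Fin 3) k} {d : ℕ}

/-- The space of homogeneous syzygies of degree `n`. -/
def syzDegree (f : MvPolynomial (Fin 3) k) (n : ℕ) : Submodule k (syz f) :=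
  (Submodule.pi Set.univ fun _ : Fin 3 => homogeneousSubmodule (Fin 3) k n).comap
    ((syz f).subtype.restrictScalars k)

lemma mem_syzDegree_iff {n : ℕ} {s : syz f} :
    s ∈ syzDegree f n ↔ IsHomogeneousVec (s : Fin 3 → MvPolynomial (Fin 3) k) n := by
  simp [syzDegree, IsHomogeneousVec, Submodule.mem_pi]

lemma range_compLeft_subtype (n : ℕ) :
    LinearMap.range ((homogeneousSubmodule (Fin 3) k n).subtype.compLeft (Fin 3)) =
      Submodule.pi Set.univ fun _ : Fin 3 => homogeneousSubmodule (Fin 3) k n := by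
  ext s
  simp only [LinearMap.mem_range, Submodule.mem_pi, Set.mem_univ, true_imp_iff]
  constructor
  · rintro ⟨t, rfl⟩ i
    exact (t i).2
  · intro h
    exact ⟨fun i => ⟨s i, h i⟩, rfl⟩

instance finite_pi_homogeneousSubmodule (n : ℕ) : Module.Finite k
    (Submodule.pi Set.univ fun _ : Fin 3 => homogeneousSubmodule (Fin 3) k n) := by
  rw [← range_compLeft_subtype]
  infer_instance

lemma finrank_pi_homogeneousSubmodule (n : ℕ) : Module.finrank k
    (Submodule.pi Set.univ fun _ : Fin 3 => homogeneousSubmodule (Fin 3) k n) =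
      3 * Module.finrank k (homogeneousSubmodule (Fin 3) k n) := by
  rw [← range_compLeft_subtype, LinearMap.finrank_range_of_inj, Module.finrank_pi_fintype]
  · simp
  · intro s t h
    exact funext fun i => Subtype.ext (congrFun h i)

instance finite_syzDegree (n : ℕ) : Module.Finite k (syzDegree f n) := by
  have hinj : Function.Injective ((syz f).subtype.restrictScalars k) := Subtype.val_injective
  have : Module.Finite k ((syzDegree f n).map ((syz f).subtype.restrictScalars k)) :=
    Submodule.finiteDimensional_of_le (Submodule.map_comap_le _ _)
  exact Module.Finite.equiv (Submodule.equivMapOfInjective _ hinj (syzDegree f n)).symm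

/-- Dimension count in the exact sequence `0 → Syz(J) → R³ → J(d) → 0`. -/
lemma finrank_syzDegree (hf : f.IsHomogeneous (d + 1)) (n : ℕ) :
    Module.finrank k (syzDegree f n) + Module.finrank k (homogeneousSubmodule (Fin 3) k (n + d)) =
      3 * Module.finrank k (homogeneousSubmodule (Fin 3) k n) +
        hilbertFunction (Ideal.span (Set.range (grad f))) (n + d) := by
  let L : (Fin 3 → MvPolynomial (Fin 3) k) →ₗ[k] MvPolynomial (Fin 3) k :=
    (Fintype.linearCombination (MvPolynomial (Fin 3) k) (grad f)).restrictScalars k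
  let S : Submodule k (Fin 3 → MvPolynomial (Fin 3) k) :=
    Submodule.pi Set.univ fun _ : Fin 3 => homogeneousSubmodule (Fin 3) k n
  have hg := grad_isHomogeneous hf
  have hL : ∀ s, L s = ∑ i, s i * grad f i := fun s => by
    simp [L, Fintype.linearCombination_apply]
  have hker : Module.finrank k (S ⊓ LinearMap.ker L : Submodule k _) =
      Module.finrank k (syzDegree f n) := by
    have hinj : Function.Injective ((syz f).subtype.restrictScalars k) := Subtype.val_injective
    have hrange : LinearMap.range ((syz f).subtype.restrictScalars k) = LinearMap.ker L := by
      ext s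
      simp only [LinearMap.mem_ker, LinearMap.mem_range, hL]
      exact ⟨fun ⟨t, ht⟩ => ht ▸ mem_syz_iff.1 t.2, fun h => ⟨⟨s, mem_syz_iff.2 h⟩, rfl⟩⟩
    rw [(Submodule.equivMapOfInjective _ hinj (syzDegree f n)).finrank_eq, syzDegree,
      Submodule.map_comap_eq, inf_comm, hrange]
  have himage : S.map L = (homogeneousSubmodule (Fin 3) k (n + d) ⊓
      (Ideal.span (Set.range (grad f))).restrictScalars k : Submodule k _) := by
    ext a
    constructor
    · rintro ⟨s, hs, rfl⟩
      rw [hL]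
      refine ⟨IsHomogeneous.sum _ _ _ fun i _ => ?_, ?_⟩
      · exact (hs i (Set.mem_univ i)).mul (hg i)
      · exact Ideal.sum_mem _ fun i _ => Ideal.mul_mem_left _ _ (Ideal.subset_span ⟨i, rfl⟩)
    · rintro ⟨ha, haJ⟩
      obtain ⟨c, hc⟩ := Ideal.mem_span_range_iff_exists_fun.1 haJ
      refine ⟨fun i => homogeneousComponent n (c i), fun i _ =>
        homogeneousComponent_isHomogeneous n (c i), ?_⟩
      rw [hL]
      simp only [← homogeneousComponent_mul_add (hg _)]
      rw [← map_sum, hc]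
      exact homogeneousComponent_eq_self ha
  have h1 := finrank_map_add_finrank_inf_ker S L
  have h2 := hilbertFunction_add_finrank (Ideal.span (Set.range (grad f))) (n + d)
  rw [hker, himage] at h1
  have h3 : Module.finrank k S = 3 * Module.finrank k (homogeneousSubmodule (Fin 3) k n) :=
    finrank_pi_homogeneousSubmodule n
  omega

variable {ε : syz f} {π : syz f →ₗ[MvPolynomial (Fin 3) k] MvPolynomial (Fin 3) k}

lemma isHomogeneousVec_smul_iff (hε : IsInitialSyzygy f ε) {a : MvPolynomial (Fin 3) k}
    (ha : a ≠ 0) {n : ℕ} :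
    IsHomogeneousVec ((a • ε : syz f) : Fin 3 → MvPolynomial (Fin 3) k) n ↔
      ∃ m, m + indeg f = n ∧ a.IsHomogeneous m := by
  constructor
  · intro h
    obtain ⟨i, hi⟩ := Function.ne_iff.1 fun h : (ε : Fin 3 → MvPolynomial (Fin 3) k) = 0 =>
      hε.1 (Subtype.ext h)
    exact isHomogeneous_of_mul_right (hε.2 i) hi ha (h i)
  · rintro ⟨m, rfl, hm⟩ i
    exact hm.mul (hε.2 i)

/-- The multiples of `ε` of degree `n` form a copy of the forms of degree `n - e`. -/
lemma finrank_syzDegree_inf_ker (hε : IsInitialSyzygy f ε)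
    (hker : LinearMap.ker π = Submodule.span (MvPolynomial (Fin 3) k) {ε}) (n : ℕ) :
    Module.finrank k (syzDegree f n ⊓ LinearMap.ker (π.restrictScalars k) : Submodule k _) =
      if indeg f ≤ n then Module.finrank k (homogeneousSubmodule (Fin 3) k (n - indeg f))
      else 0 := by
  have hmem : ∀ s : syz f, s ∈ LinearMap.ker (π.restrictScalars k) ↔
      ∃ a : MvPolynomial (Fin 3) k, a • ε = s := fun s => by
    rw [← Submodule.mem_span_singleton, ← hker]
    rfl
  split_ifs with hn
  · let μ : MvPolynomial (Fin 3) k →ₗ[k] syz f :=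
      (LinearMap.toSpanSingleton (MvPolynomial (Fin 3) k) (syz f) ε).restrictScalars k
    have hμ : Function.Injective μ := smul_left_injective _ hε.1
    suffices h : (syzDegree f n ⊓ LinearMap.ker (π.restrictScalars k) : Submodule k _) =
        (homogeneousSubmodule (Fin 3) k (n - indeg f)).map μ by
      rw [h, (Submodule.equivMapOfInjective μ hμ _).finrank_eq]
    ext s
    rw [Submodule.mem_inf, hmem, mem_syzDegree_iff, Submodule.mem_map]
    constructor
    · rintro ⟨h, a, rfl⟩
      by_cases ha : a = 0
      · exact ⟨0, zero_mem _, by simp [ha]⟩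
      · obtain ⟨m, hm, ham⟩ := (isHomogeneousVec_smul_iff hε ha).1 h
        obtain rfl : m = n - indeg f := by omega
        exact ⟨a, ham, rfl⟩
    · rintro ⟨a, ha, rfl⟩
      refine ⟨?_, a, rfl⟩
      by_cases ha0 : a = 0
      · intro i
        simp [μ, ha0, isHomogeneous_zero]
      · exact (isHomogeneousVec_smul_iff hε ha0).2 ⟨_, Nat.sub_add_cancel hn, ha⟩
  · have : (syzDegree f n ⊓ LinearMap.ker (π.restrictScalars k) : Submodule k _) = ⊥ := by
      rw [Submodule.eq_bot_iff]
      rintro s ⟨h, hs⟩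
      obtain ⟨a, rfl⟩ := (hmem s).1 hs
      by_contra hne
      have ha : a ≠ 0 := by
        rintro rfl
        exact hne (zero_smul _ _)
      obtain ⟨m, hm, -⟩ := (isHomogeneousVec_smul_iff hε ha).1 (mem_syzDegree_iff.1 h)
      omega
    rw [this, finrank_bot]

/-- The graded pieces of the image of a Bourbaki map are the images of the graded pieces. -/
lemma map_syzDegree (hf0 : f ≠ 0) (hf : f.IsHomogeneous (d + 1)) (hπ : IsBourbakiGraded f π)
    {m n : ℕ} (hmn : m + d = n + indeg f) :
    (syzDegree f n).map (π.restrictScalars k) =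
      (homogeneousSubmodule (Fin 3) k m ⊓
        Submodule.restrictScalars k (LinearMap.range π) : Submodule k _) := by
  ext a
  constructor
  · rintro ⟨s, hs, rfl⟩
    refine ⟨?_, s, rfl⟩
    rcases hπ n s (mem_syzDegree_iff.1 hs) with h | ⟨m', hm', h⟩
    · change π s ∈ _
      rw [h]
      exact zero_mem _
    · rw [hf.totalDegree hf0] at hm'
      obtain rfl : m' = m := by omega
      exact h
  · rintro ⟨ha, s, rfl⟩
    refine ⟨syzComponent hf n s, mem_syzDegree_iff.2 (isHomogeneousVec_syzComponent hf n s), ?_⟩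
    exact (hπ.homogeneousComponent_apply hf0 hf hmn s).symm.trans (homogeneousComponent_eq_self ha)

/-- Dimension count in the exact sequence `0 → R(-e) → Syz(J) → I(e - d) → 0`. -/
lemma hilbertFunction_add_finrank_syzDegree (hf0 : f ≠ 0) (hf : f.IsHomogeneous (d + 1))
    (hε : IsInitialSyzygy f ε) {I : Ideal (MvPolynomial (Fin 3) k)} (hI : IsBourbakiIdeal f ε I)
    {m n : ℕ} (hmn : m + d = n + indeg f) :
    hilbertFunction I m + Module.finrank k (syzDegree f n) =
      Module.finrank k (homogeneousSubmodule (Fin 3) k m) +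
        if indeg f ≤ n then Module.finrank k (homogeneousSubmodule (Fin 3) k (n - indeg f))
        else 0 := by
  obtain ⟨-, -, π, hker, hrange, hgr⟩ := hI
  subst hrange
  have h1 := finrank_map_add_finrank_inf_ker (syzDegree f n) (π.restrictScalars k)
  rw [finrank_syzDegree_inf_ker hε hker, map_syzDegree hf0 hf hgr hmn] at h1
  have h2 := hilbertFunction_add_finrank (LinearMap.range π) m
  omega

/-- The Hilbert function of a Bourbaki ideal depends only on the curve. -/
lemma hilbertFunction_eq (hf0 : f ≠ 0) (hf : f.IsHomogeneous (d + 1)) (hg : grad f ≠ 0)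
    {ε' : syz f} (hε : IsInitialSyzygy f ε) (hε' : IsInitialSyzygy f ε')
    {I I' : Ideal (MvPolynomial (Fin 3) k)} (hI : IsBourbakiIdeal f ε I)
    (hI' : IsBourbakiIdeal f ε' I') : hilbertFunction I = hilbertFunction I' := by
  funext m
  have hle := indeg_le_degree hf hg
  have h1 := hilbertFunction_add_finrank_syzDegree hf0 hf hε hI
    (m := m) (n := m + d - indeg f) (by omega)
  have h2 := hilbertFunction_add_finrank_syzDegree hf0 hf hε' hI'
    (m := m) (n := m + d - indeg f) (by omega)
  omega

/-- In large degrees, the Hilbert functions of a Bourbaki ideal and of the Jacobian ideal add up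
to `d² - e (d - e)`. -/
lemma hilbertFunction_add_jacobian (hf0 : f ≠ 0) (hf : f.IsHomogeneous (d + 1)) (hg : grad f ≠ 0)
    (hε : IsInitialSyzygy f ε) {I : Ideal (MvPolynomial (Fin 3) k)} (hI : IsBourbakiIdeal f ε I)
    {m n : ℕ} (hmn : m + d = n + indeg f) (hn : indeg f ≤ n) :
    hilbertFunction I m + hilbertFunction (Ideal.span (Set.range (grad f))) (n + d) +
      indeg f * (d - indeg f) = d ^ 2 := by
  have h1 := hilbertFunction_add_finrank_syzDegree hf0 hf hε hI hmn
  rw [if_pos hn] at h1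
  have h2 := finrank_syzDegree hf n
  have r1 := finrank_homogeneousSubmodule (k := k) m
  have r2 := finrank_homogeneousSubmodule (k := k) n
  have r3 := finrank_homogeneousSubmodule (k := k) (n - indeg f)
  have r4 := finrank_homogeneousSubmodule (k := k) (n + d)
  have hle := indeg_le_degree hf hg
  generalize indeg f = e at *
  obtain ⟨c, rfl⟩ := Nat.exists_eq_add_of_le hle
  obtain ⟨l, rfl⟩ := Nat.exists_eq_add_of_le hn
  have hm : m + c = e + l := by omega
  simp only [Nat.add_sub_cancel_left] at *
  zify at *
  rw [show (m : ℤ) = e + l - c by linarith] at r1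
  have key : 2 * ((hilbertFunction I m : ℤ) +
      hilbertFunction (Ideal.span (Set.range (grad f))) (e + l + (e + c)) + e * c) =
      2 * (e + c) ^ 2 := by
    linear_combination 2 * h1 - 2 * h2 + r1 - 3 * r2 + r3 + r4
  linarith

end BourbakiHilbert

/-! ### Existence of Bourbaki ideals and their degree -/

section Existence

variable {k : Type*} [Field k] {f : MvPolynomial (Fin 3) k} {d : ℕ}

attribute [local instance] MvPolynomial.gradedAlgebra in
lemma IsBourbakiGraded.isHomogeneous_range (hf0 : f ≠ 0) (hf : f.IsHomogeneous (d + 1))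
    (hg : grad f ≠ 0) {π : syz f →ₗ[MvPolynomial (Fin 3) k] MvPolynomial (Fin 3) k}
    (hπ : IsBourbakiGraded f π) :
    Ideal.IsHomogeneous (homogeneousSubmodule (Fin 3) k) (LinearMap.range π) := by
  rintro m _ ⟨s, rfl⟩
  rw [coe_decompose_eq_homogeneousComponent]
  have hle := indeg_le_degree hf hg
  exact ⟨_, (hπ.homogeneousComponent_apply hf0 hf (m := m) (n := m + d - indeg f)
    (by omega) s).symm⟩

/-- The image of `s ↦ (ε × s) / grad f` is a saturated Bourbaki ideal. -/
lemma exists_isBourbakiIdeal [IsAlgClosed k] (hf0 : f ≠ 0) (hf : f.IsHomogeneous (d + 1))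
    (hg : IsPrimitiveVec (grad f)) {ε : syz f} (hε : IsInitialSyzygy f ε) :
    ∃ I, IsBourbakiIdeal f ε I ∧ IsSaturated I := by
  obtain ⟨π, hπ⟩ := exists_linearMap_cross_eq_smul hg ε
  have hεp := hε.isPrimitiveVec hf
  have hker := ker_of_cross hg.1 hεp hπ
  have hgr := isBourbakiGraded_of_cross hf0 hf hg.1 hε hπ
  have hhom := hgr.isHomogeneous_range hf0 hf hg.1
  have hsat : IsSaturated (LinearMap.range π) :=
    isSaturated_range π ε hker (fun a ha => (smul_eq_zero.1 ha).resolve_right hε.1)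
      exists_eq_X_smul_syz
  exact ⟨LinearMap.range π, ⟨hhom, eq_top_or_height_eq_two hhom hsat hεp
    (coord_mem_range_of_cross hg.1 hπ), π, hker, rfl, hgr⟩, hsat⟩

lemma quotientDegree_eq_bourbakiDegree (hf0 : f ≠ 0) (hf : f.IsHomogeneous (d + 1))
    (hg : grad f ≠ 0) {ε : syz f} (hε : IsInitialSyzygy f ε)
    {I : Ideal (MvPolynomial (Fin 3) k)} (hI : IsBourbakiIdeal f ε I) :
    quotientDegree I = bourbakiDegree f := by
  have hex : ∃ I : Ideal (MvPolynomial (Fin 3) k),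
      ∃ ε : syz f, IsInitialSyzygy f ε ∧ IsBourbakiIdeal f ε I := ⟨I, ε, hε, hI⟩
  rw [bourbakiDegree, dif_pos hex]
  obtain ⟨ε', hε', hI'⟩ := hex.choose_spec
  exact quotientDegree_congr (hilbertFunction_eq hf0 hf hg hε hε' hI hI')

/-- The Bourbaki degree is `d² - e (d - e) - τ`, where `τ` is the eventual value of the Hilbert
function of the Jacobian ideal; the ideal has degree zero only if it is the unit ideal. -/
lemma exists_bourbakiDegree_eq [IsAlgClosed k] (hf0 : f ≠ 0) (hf : f.IsHomogeneous (d + 1))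
    (hg : IsPrimitiveVec (grad f)) :
    ∃ v τ N : ℕ, bourbakiDegree f = v ∧ v + τ + indeg f * (d - indeg f) = d ^ 2 ∧
      ∀ n, N ≤ n → hilbertFunction (Ideal.span (Set.range (grad f))) n = τ := by
  obtain ⟨ε, hε⟩ := exists_isInitialSyzygy hf hg.1
  obtain ⟨I, hI, hsat⟩ := exists_isBourbakiIdeal hf0 hf hg hε
  have hle := indeg_le_degree hf hg.1
  have hsum : ∀ m, 2 * indeg f ≤ m + d → hilbertFunction I m +
      hilbertFunction (Ideal.span (Set.range (grad f))) (m + d - indeg f + d) +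
      indeg f * (d - indeg f) = d ^ 2 := fun m hm =>
    hilbertFunction_add_jacobian hf0 hf hg.1 hε hI (by omega) (by omega)
  have : Infinite k := IsAlgClosed.instInfinite
  obtain ⟨N, v, hv⟩ := exists_eventually_eq_of_monotone hsat.monotone_hilbertFunction
    (M := 2 * indeg f) (B := d ^ 2) fun m hm => by
      have := hsum m (by omega)
      omega
  refine ⟨v, d ^ 2 - indeg f * (d - indeg f) - v, N + 2 * d + 2 * indeg f, ?_, ?_, ?_⟩
  · rw [← quotientDegree_eq_bourbakiDegree hf0 hf hg.1 hε hI]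
    -- If the Hilbert polynomial vanishes, the degree is the length of `R / I`; this length is zero,
    -- because a saturated ideal containing a power of the irrelevant ideal is the unit ideal.
    by_cases hv0 : v = 0
    · subst hv0
      obtain ⟨M, hM⟩ := exists_pow_le_of_hilbertFunction hv
      rw [hsat.eq_top_of_pow_le hM, quotientDegree_top, Nat.cast_zero]
    · exact quotientDegree_of_eventually hv hv0
  · have h1 := hsum (N + 2 * indeg f) (by omega)
    rw [hv _ (by omega)] at h1
    omega
  · intro n hn
    have h1 := hsum (n - 2 * d + indeg f) (by omega)
    rw [hv _ (by omega), show n - 2 * d + indeg f + d - indeg f + d = n by omega] at h1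
    omega

end Existence

end PlaneCurve

end

theorem mainTheorem4 {k : Type*} [Field k] [IsAlgClosed k] (d : ℕ) (hd : 2 ≤ d + 1)
    (hchar : ((d + 1 : ℕ) : k) ≠ 0)
    (f : MvPolynomial (Fin 3) k) (hf0 : f ≠ 0) (hf : f.IsHomogeneous (d + 1))
    (hred : (Ideal.span {f}).IsRadical) :
    -- the Bourbaki degree is well defined
    ((∃ ε, PlaneCurve.IsInitialSyzygy f ε) ∧
      ∀ ε, PlaneCurve.IsInitialSyzygy f ε →
        (∃ I, PlaneCurve.IsBourbakiIdeal f ε I) ∧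
        ∀ I, PlaneCurve.IsBourbakiIdeal f ε I →
          PlaneCurve.quotientDegree I = PlaneCurve.bourbakiDegree f) ∧
    -- it equals `d ^ 2` exactly for smooth curves
    (PlaneCurve.bourbakiDegree f = (d : ℚ) ^ 2 ↔ PlaneCurve.IsSmooth f) ∧
    -- for smooth curves the gradient is a regular sequence, and all syzygies are Koszul
    (PlaneCurve.IsSmooth f →
      RingTheory.Sequence.IsRegular (MvPolynomial (Fin 3) k)
        [MvPolynomial.pderiv 0 f, MvPolynomial.pderiv 1 f, MvPolynomial.pderiv 2 f] ∧
      PlaneCurve.syz f = Submodule.span (MvPolynomial (Fin 3) k)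
        (Set.range fun ij : Fin 3 × Fin 3 => PlaneCurve.koszul f ij.1 ij.2) ∧
      PlaneCurve.indeg f = d) := by
  have hg := PlaneCurve.isPrimitiveVec_grad hchar hf0 hf hred
  have hd0 : 0 < d := by omega
  have hsmooth : PlaneCurve.IsSmooth f →
      RingTheory.Sequence.IsRegular (MvPolynomial (Fin 3) k)
        [MvPolynomial.pderiv 0 f, MvPolynomial.pderiv 1 f, MvPolynomial.pderiv 2 f] ∧
      PlaneCurve.syz f = Submodule.span (MvPolynomial (Fin 3) k)
        (Set.range fun ij : Fin 3 × Fin 3 => PlaneCurve.koszul f ij.1 ij.2) ∧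
      PlaneCurve.indeg f = d := by
    intro hsm
    obtain ⟨N, hN⟩ := (PlaneCurve.isSmooth_iff_exists_pow_le hchar hf).1 hsm
    have hsyz := PlaneCurve.syz_eq_span_koszul hd0 hf hN
    exact ⟨PlaneCurve.isRegular_of_pow_le hd0 (PlaneCurve.grad_isHomogeneous hf) hN, hsyz,
      le_antisymm (PlaneCurve.indeg_le_degree hf hg.1) (PlaneCurve.le_indeg hf hg.1 hsyz)⟩
  refine ⟨⟨PlaneCurve.exists_isInitialSyzygy hf hg.1, fun ε hε => ⟨?_, fun I hI =>
    PlaneCurve.quotientDegree_eq_bourbakiDegree hf0 hf hg.1 hε hI⟩⟩, ?_, hsmooth⟩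
  · obtain ⟨I, hI, -⟩ := PlaneCurve.exists_isBourbakiIdeal hf0 hf hg hε
    exact ⟨I, hI⟩
  · obtain ⟨v, τ, N, hv, hsum, hτ⟩ := PlaneCurve.exists_bourbakiDegree_eq hf0 hf hg
    have hiff : PlaneCurve.bourbakiDegree f = (d : ℚ) ^ 2 ↔ v = d ^ 2 := by
      rw [hv]
      exact_mod_cast Iff.rfl
    rw [hiff, PlaneCurve.isSmooth_iff_exists_pow_le hchar hf]
    constructor
    · intro h
      exact PlaneCurve.exists_pow_le_of_hilbertFunction (N := N) fun n hn => by
        rw [hτ n hn]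
        omega
    · rintro ⟨M, hM⟩
      have hτ0 : τ = 0 := by
        rw [← hτ (max M N) (le_max_right _ _)]
        exact PlaneCurve.hilbertFunction_eq_zero_of_pow_le hM (le_max_left _ _)
      have he := (hsmooth ((PlaneCurve.isSmooth_iff_exists_pow_le hchar hf).2 ⟨M, hM⟩)).2.2
      rw [hτ0, he, Nat.sub_self] at hsum
      omega
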